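/- Let $\{p_k\}_{k\ge 0}$ be a probability distribution on the nonnegative integers with $p_0=0$, $m:=\sum_k k p_k>1$ and $\sum_k b^k p_k<\infty$ for some $b>1$. Let $\omega$ be a Galton–Watson tree with offspring distribution $\{p_k\}$ and root $o$; let $\mathbb P,\mathbb E$ denote its law and the corresponding expectation, $d_v$ the number of children of a vertex $v$, and $|v|$ the distance of $v$ from $o$. For $\alpha>0$ put $\lambda=me^{-\alpha}$ and, given $\omega$, let $(Y_t)_{t\ge0}$ be the continuous-time nearest-neighbour random walk on $\omega$ that jumps from a vertex $v$ at rate $1$ to each child of $v$ and at rate $\lambda$ to the parent of $v$ (if $v\ne o$); let $P_{x,\omega}$ be its law when started at $x$. With $T(x)=\inf\{t\ge0:Y_t=x\}$ and $\tau_n=\inf\{t\ge 0:|Y_t|=n\}$, let $\beta_n(x)=P_{x,\omega}(T(\overleftarrow{x})>\tau_n)$ for $0<|x|\le n$, where $\overleftarrow{x}$ is the parent of $x$. With $x_1,\dots,x_{d_o}$ the children of $o$, let $$\beta_n(o)=\frac{\sum_{i=1}^{d_o}\beta_n(x_i)}{\lambda+\sum_{i=1}^{d_o}\beta_n(x_i)}\quad(n\ge1),\qquad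 \beta(o)=\lim_{n\to\infty}\beta_n(o).$$ Let $Z_n$ be the number of vertices $v$ with $|v|=n$, and let $W_o=\lim_{n\to\infty}Z_n/m^n$ be the Galton–Watson martingale limit. Finally let $\mathcal D^0=\dfrac{2m^2(m-1)}{\sum_k k^2p_k-m}$ (the diffusivity constant of the unbiased walk). Then, $\mathbb P$-almost surely, the limits defining $\beta(o)$ (for each $\alpha>0$) and $W_o$ exist; $\beta(o)$ is integrable and $W_o$ is square integrable; and, as $\alpha\searrow0$, $\alpha^{-1}\beta(o)$ converges in law and in expectation to an integrable random variable $Y$, that is, its law converges weakly to the law of $Y$ and $\mathbb E(\alpha^{-1}\beta(o))\to\mathbb E(Y)$. Moreover $$\mathbb E(Y)=\frac{m(m-1)}{\mathbb E(d_o^2-d_o)}=\frac{\mathcal D^0}{2m},$$ and $Y$ is equal in law to $W_o/\mathbb E(W_o^2)$. -/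

import Mathlib

open MeasureTheory ProbabilityTheory Filter Topology
open scoped ENNReal NNReal

noncomputable section

namespace GWWalk

/-! ### Galton–Watson trees

The vertices of a rooted tree are labelled by finite words: the empty word `[]` is the root `o`,
the children of `v` are `i :: v` for `i = 0, …, d_v - 1`, the parent of `v ≠ []` is `v.tail`, and
the distance `|v|` of `v` from the root is `v.length`. A tree is described by the numbers of
children `d_v = ω v`; the values at words that are not vertices of the tree play no role. -/

/-- Labels of vertices. -/
abbrev Vertex : Type := List ℕ

instance instMeasurableSpaceVertex : MeasurableSpace (List ℕ) := ⊤

instance instDiscreteMeasurableSpaceVertex : DiscreteMeasurableSpace (List ℕ) :=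
  ⟨fun _ => trivial⟩

/-- A rooted tree, given by the number of children of each vertex. -/
abbrev Tree : Type := Vertex → ℕ

/-- `v` is a vertex of the tree `ω`. -/
def IsVertex (ω : Tree) : Vertex → Prop
  | [] => True
  | i :: v => i < ω v ∧ IsVertex ω v

/-- The law of the Galton–Watson tree with offspring distribution `p`: the numbers of children are
independent with law `p`. -/
def galtonWatson (p : PMF ℕ) : Measure Tree :=
  Measure.infinitePi fun _ : Vertex => p.toMeasure

instance instIsProbabilityMeasureGaltonWatson (p : PMF ℕ) :
    IsProbabilityMeasure (galtonWatson p) := by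
  unfold galtonWatson; infer_instance

/-- The mean `m = ∑ k p_k` of the offspring distribution. -/
def mean (p : PMF ℕ) : ℝ := ∑' k : ℕ, (k : ℝ) * (p k).toReal

/-- The second moment `∑ k² p_k` of the offspring distribution. -/
def secondMoment (p : PMF ℕ) : ℝ := ∑' k : ℕ, (k : ℝ) ^ 2 * (p k).toReal

/-- The constant `𝒟⁰ = 2 m² (m - 1) / (∑ k² p_k - m)`. -/
def diffusivity (p : PMF ℕ) : ℝ :=
  2 * mean p ^ 2 * (mean p - 1) / (secondMoment p - mean p)

/-- `Z_n`, the number of vertices of `ω` at distance `n` from the root. -/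
def generationSize (ω : Tree) (n : ℕ) : ℕ := {v : Vertex | IsVertex ω v ∧ v.length = n}.ncard

/-- The Galton–Watson martingale `W(o, n) = Z_n / m ^ n`. -/
def martingaleW (p : PMF ℕ) (ω : Tree) (n : ℕ) : ℝ := (generationSize ω n : ℝ) / mean p ^ n

/-- `W_o = lim_n W(o, n)`. -/
def limitW (p : PMF ℕ) (ω : Tree) : ℝ := limUnder atTop (martingaleW p ω)

/-! ### The biased random walk in continuous time -/

/-- The jump rates out of `v`, as a measure on the possible targets: rate `1` toward each child and
rate `lam` toward the parent (if there is one). -/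
def rateMeasure (ω : Tree) (lam : ℝ) (v : Vertex) : Measure Vertex :=
  (∑ i ∈ Finset.range (ω v), Measure.dirac (i :: v)) +
    (if v = [] then 0 else ENNReal.ofReal lam • Measure.dirac v.tail)

/-- The total jump rate out of `v`. -/
def totalRate (ω : Tree) (lam : ℝ) (v : Vertex) : ℝ≥0∞ := rateMeasure ω lam v Set.univ

lemma totalRate_ne_top (ω : Tree) (lam : ℝ) (v : Vertex) : totalRate ω lam v ≠ ⊤ := by
  unfold totalRate rateMeasure
  by_cases hv : v = [] <;> simp [hv]

/-- The law of the vertex visited after `v`; a vertex with total jump rate `0` is absorbing. -/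
def jumpMeasure (ω : Tree) (lam : ℝ) (v : Vertex) : Measure Vertex :=
  if totalRate ω lam v = 0 then Measure.dirac v
  else (totalRate ω lam v)⁻¹ • rateMeasure ω lam v

/-- The transition kernel of the embedded jump chain. -/
def jumpKernel (ω : Tree) (lam : ℝ) : Kernel Vertex Vertex :=
  Kernel.ofFunOfCountable (jumpMeasure ω lam)

instance instIsMarkovKernelJumpKernel (ω : Tree) (lam : ℝ) :
    IsMarkovKernel (jumpKernel ω lam) := by
  refine ⟨fun v => ⟨?_⟩⟩
  change jumpMeasure ω lam v Set.univ = 1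
  unfold jumpMeasure
  split_ifs with h
  · simp
  · rw [Measure.smul_apply, smul_eq_mul]
    exact ENNReal.inv_mul_cancel h (totalRate_ne_top ω lam v)

/-- The law of the embedded jump chain started at `x`. -/
def jumpChain (ω : Tree) (lam : ℝ) (x : Vertex) : Measure (ℕ → Vertex) :=
  Kernel.traj (X := fun _ => Vertex)
    (fun n => (jumpKernel ω lam).comap
      (fun h : (i : Finset.Iic n) → Vertex => h ⟨n, Finset.mem_Iic.2 le_rfl⟩)
      (measurable_pi_apply _))
    0 (fun _ => x)

instance instIsProbabilityMeasureExp : IsProbabilityMeasure (expMeasure 1) :=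
  isProbabilityMeasure_expMeasure one_pos

/-- `P_{x, ω}`: the law of the walk started at `x`, encoded by its jump chain together with an
independent sequence of i.i.d. standard exponential variables; the holding time at the `k`-th
visited vertex is the `k`-th exponential variable divided by the total jump rate there. -/
def walkLaw (ω : Tree) (lam : ℝ) (x : Vertex) : Measure ((ℕ → Vertex) × (ℕ → ℝ)) :=
  (jumpChain ω lam x).prod (Measure.infinitePi fun _ : ℕ => expMeasure 1)

/-- The time of the `n`-th jump. -/
def jumpTime (ω : Tree) (lam : ℝ) (η : (ℕ → Vertex) × (ℕ → ℝ)) (n : ℕ) : ℝ≥0∞ :=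
  ∑ k ∈ Finset.range n, ENNReal.ofReal (η.2 k) / totalRate ω lam (η.1 k)

open Classical in
/-- The position `Y_t` of the walk at time `t` (`none` after an explosion). -/
def position (ω : Tree) (lam : ℝ) (η : (ℕ → Vertex) × (ℕ → ℝ)) (t : ℝ≥0) : Option Vertex :=
  if h : ∃ n, jumpTime ω lam η n ≤ (t : ℝ≥0∞) ∧ (t : ℝ≥0∞) < jumpTime ω lam η (n + 1) then
    some (η.1 (Nat.find h))
  else none

/-- The hitting time `T(x) = inf {t ≥ 0 : Y_t = x}`. -/
def hitVertex (ω : Tree) (lam : ℝ) (x : Vertex) (η : (ℕ → Vertex) × (ℕ → ℝ)) : ℝ≥0∞ :=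
  ⨅ (t : ℝ≥0) (_ : position ω lam η t = some x), (t : ℝ≥0∞)

/-- The hitting time `τ_n = inf {t ≥ 0 : |Y_t| = n}`. -/
def hitLevel (ω : Tree) (lam : ℝ) (n : ℕ) (η : (ℕ → Vertex) × (ℕ → ℝ)) : ℝ≥0∞ :=
  ⨅ (t : ℝ≥0) (_ : ∃ v, position ω lam η t = some v ∧ v.length = n), (t : ℝ≥0∞)

/-! ### Escape probabilities -/

/-- `β_n(x) = P_{x, ω} (T(parent of x) > τ_n)`, meant for `0 < |x| ≤ n`. -/
def escapeBefore (ω : Tree) (lam : ℝ) (n : ℕ) (x : Vertex) : ℝ :=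
  (walkLaw ω lam x).real {η | hitLevel ω lam n η < hitVertex ω lam x.tail η}

/-- `β_n(o) = ∑ β_n(x_i) / (lam + ∑ β_n(x_i))`, the sums being over the children `x_i` of the
root `o`, for `n ≥ 1`. -/
def escapeBeforeRoot (ω : Tree) (lam : ℝ) (n : ℕ) : ℝ :=
  (∑ i ∈ Finset.range (ω []), escapeBefore ω lam n [i]) /
    (lam + ∑ i ∈ Finset.range (ω []), escapeBefore ω lam n [i])

/-- The bias `λ_α = m e^{-α}` toward the root. -/
def bias (p : PMF ℕ) (α : ℝ) : ℝ := mean p * Real.exp (-α)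

/-- `β(o) = lim_n β_n(o)` for the walk with bias `λ_α`. -/
def escapeRoot (p : PMF ℕ) (α : ℝ) (ω : Tree) : ℝ :=
  limUnder atTop (escapeBeforeRoot ω (bias p α))

end GWWalk

end

open GWWalk

namespace GWWalk

/-! ### Exit distributions of the jump chain -/

/-! Write `β` for the escape probability of the root, `S` for the sum of the escape probabilities of
its children in their own subtrees, `a = E β` and `λ = m e^{-α}`. As `p₀ = 0`, there are no leaves
almost surely. Solving the exit problem of the jump chain between the root and level `n` identifies
the quantities `β_n` with conductances given by a recursion (`jumpChain_escape`,
`escapeBefore_eq_conductance`), and in the limit `β (λ + S) = S` (`escapeRoot_mul_eq`).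

Equivalently `β = (1 - β) S / λ`. When `α` is small, `β` is small, so `β / a` is almost a fixed
point of the branching operator that sums over the children and divides by `m`. On centred functions
this operator multiplies squared `L²` norms by `1/m` (`memLp_subtreeSum`). The martingale limit `W`
is an exact fixed point with mean one, so the difference `β / a - W` is centred and is contracted up
to an error controlled by `E β²` and `E (W² β²)`, both of which vanish. Hence `β / a → W` in `L²`
(`tendsto_sqDist`). Dividing by `a` requires `a > 0`, which comes from an energy bound
(`integral_escapeRoot_pos`).

The constant comes from integrating the recursion: `(m - λ) a = E (β S)`. Since `β / a` and `S / (m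
a)` both tend to `W` in `L²`, `(m - λ) / a → m E W²`. As `(m - λ) / α → m`, it follows that `a / α →
1 / E W²`, so `β / α → W / E W²` in `L²`. The value of `E W²` follows from the fixed point equation
(`integral_sq_limitW`). -/

lemma measurableSet_stay (D : Set Vertex) (k : ℕ) :
    MeasurableSet {X : ℕ → Vertex | ∀ l < k, X l ∈ D} := by
  simp only [Set.ofPred_forall]
  refine MeasurableSet.iInter fun l => MeasurableSet.iInter fun _ => ?_
  exact (measurable_pi_apply l) (MeasurableSet.of_discrete (s := D))

instance instIsProbabilityMeasureJumpChain (ω : Tree) (lam : ℝ) (x : Vertex) :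
    IsProbabilityMeasure (jumpChain ω lam x) := by
  unfold jumpChain; infer_instance

/-- Markov property at time `k`: the event depends only on the first `k + 1` positions, whose joint
law with the next position is a composition-product. -/
lemma lintegral_jumpChain_succ (ω : Tree) (lam : ℝ) (x : Vertex) (D : Set Vertex) (k : ℕ)
    (f : Vertex → ℝ≥0∞) :
    ∫⁻ X in {X | ∀ l < k + 1, X l ∈ D}, f (X (k + 1)) ∂jumpChain ω lam x =
      ∫⁻ X in {X | ∀ l < k + 1, X l ∈ D}, ∫⁻ y, f y ∂jumpMeasure ω lam (X k)
        ∂jumpChain ω lam x := by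
  classical
  set A : Set ((i : Finset.Iic k) → Vertex) := {h | ∀ l, h l ∈ D} with hA
  have hmem (X : ℕ → Vertex) :
      X ∈ {X : ℕ → Vertex | ∀ l < k + 1, X l ∈ D} ↔ Preorder.frestrictLe k X ∈ A := by
    constructor
    · intro h l
      exact h _ (Nat.lt_succ_of_le (Finset.mem_Iic.1 l.2))
    · intro h l hl
      exact h ⟨l, Finset.mem_Iic.2 (Nat.le_of_lt_succ hl)⟩
  have hAm : MeasurableSet A := .of_discrete
  have hfm : Measurable f := measurable_of_countable f
  set κ : (n : ℕ) → Kernel ((i : Finset.Iic n) → Vertex) Vertex := fun n =>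
    (jumpKernel ω lam).comap
      (fun h : (i : Finset.Iic n) → Vertex => h ⟨n, Finset.mem_Iic.2 le_rfl⟩)
      (measurable_pi_apply _) with hκ
  have key := Kernel.partialTraj_compProd_eq_map_traj (X := fun _ => Vertex) (κ := κ)
    (Nat.zero_le k) (x₀ := fun _ => x)
  have hmap := Kernel.traj_map_frestrictLe_apply (X := fun _ => Vertex) (κ := κ) 0 k (fun _ => x)
  have hφ : Measurable fun q : ((i : Finset.Iic k) → Vertex) × Vertex =>
      A.indicator (fun _ => f q.2) q.1 := by
    refine measurable_from_prod_countable_right fun h => ?_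
    by_cases hh : h ∈ A
    · simpa [hh] using hfm
    · simp [hh]
  rw [← lintegral_indicator (measurableSet_stay D (k + 1)),
    ← lintegral_indicator (measurableSet_stay D (k + 1))]
  have h1 : ∀ X : ℕ → Vertex, Set.indicator {X : ℕ → Vertex | ∀ l < k + 1, X l ∈ D}
      (fun X => f (X (k + 1))) X = (fun q : ((i : Finset.Iic k) → Vertex) × Vertex =>
      A.indicator (fun _ => f q.2) q.1) (Preorder.frestrictLe k X, X (k + 1)) := by
    intro X
    simp only [Set.indicator_apply, hmem X]
  have h2 : ∀ X : ℕ → Vertex, Set.indicator {X : ℕ → Vertex | ∀ l < k + 1, X l ∈ D}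
      (fun X => ∫⁻ y, f y ∂jumpMeasure ω lam (X k)) X =
      (fun h : (i : Finset.Iic k) → Vertex => ∫⁻ y, A.indicator (fun _ => f y) h ∂κ k h)
        (Preorder.frestrictLe k X) := by
    intro X
    simp only [Set.indicator_apply, hmem X]
    split_ifs
    · rfl
    · simp
  simp_rw [h1, h2]
  have hg : Measurable (fun X : ℕ → Vertex =>
      (Preorder.frestrictLe (π := fun _ => Vertex) k X, X (k + 1))) := by
    fun_prop
  unfold jumpChain
  rw [← lintegral_map hφ hg]
  erw [← key]
  rw [Measure.lintegral_compProd hφ, ← hmap, lintegral_map]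
  · fun_prop
  · fun_prop

lemma lintegral_jumpChain_zero (ω : Tree) (lam : ℝ) (x : Vertex) (f : Vertex → ℝ≥0∞) :
    ∫⁻ X, f (X 0) ∂jumpChain ω lam x = f x := by
  set κ : (n : ℕ) → Kernel ((i : Finset.Iic n) → Vertex) Vertex := fun n =>
    (jumpKernel ω lam).comap
      (fun h : (i : Finset.Iic n) → Vertex => h ⟨n, Finset.mem_Iic.2 le_rfl⟩)
      (measurable_pi_apply _) with hκ
  have hmap := Kernel.traj_map_frestrictLe_apply (X := fun _ => Vertex) (κ := κ) 0 0 (fun _ => x)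
  have h1 : ∫⁻ X, f (X 0) ∂jumpChain ω lam x = ∫⁻ h : (i : Finset.Iic 0) → Vertex,
      f (h ⟨0, Finset.mem_Iic.2 le_rfl⟩)
      ∂(Kernel.traj (X := fun _ => Vertex) κ 0 (fun _ => x)).map
        (Preorder.frestrictLe (π := fun _ => Vertex) 0) := by
    rw [lintegral_map (measurable_of_countable _) (by fun_prop)]
    rfl
  rw [h1, hmap, Kernel.partialTraj_self, Kernel.id_apply,
    lintegral_dirac' _ (measurable_of_countable _)]

/-- If the chain leaves `D` almost surely (as witnessed by a function `φ` that decreases by at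
least one in mean at each step inside `D`), a bounded function `g` that is harmonic in `D` and
equals the indicator of `T` outside `D` gives the probability that the chain leaves `D` through
`T`. -/
theorem jumpChain_exit (ω : Tree) (lam : ℝ) (x : Vertex) (D T : Set Vertex)
    (hDT : Disjoint D T) (g φ : Vertex → ℝ≥0∞) (hg1 : ∀ v, g v ≤ 1)
    (hg : ∀ v ∈ D, ∫⁻ y, g y ∂jumpMeasure ω lam v = g v)
    (hgT : ∀ v ∈ T, g v = 1) (hg0 : ∀ v, v ∉ D → v ∉ T → g v = 0)
    (hφx : φ x ≠ ⊤) (hφ : ∀ v ∈ D, ∫⁻ y, φ y ∂jumpMeasure ω lam v + 1 ≤ φ v) :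
    jumpChain ω lam x {X | ∃ j, (∀ l < j, X l ∈ D) ∧ X j ∈ T} = g x := by
  set P := jumpChain ω lam x
  set S : ℕ → Set (ℕ → Vertex) := fun k => {X | ∀ l < k, X l ∈ D} with hS
  have hSm : ∀ k, MeasurableSet (S k) := measurableSet_stay D
  have hm (f : Vertex → ℝ≥0∞) (k : ℕ) : Measurable fun X : ℕ → Vertex => f (X k) :=
    (measurable_of_countable f).comp (measurable_pi_apply k)
  have hS0 : S 0 = Set.univ := by ext; simp [hS]
  have hSsucc (k : ℕ) : S (k + 1) = S k ∩ {X | X k ∈ D} := by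
    ext X
    simp only [hS, Set.mem_ofPred_eq, Set.mem_inter_iff, Nat.lt_succ_iff_lt_or_eq]
    constructor
    · exact fun h => ⟨fun l hl => h l (Or.inl hl), h k (Or.inr rfl)⟩
    · rintro ⟨h, h'⟩ l (hl | rfl)
      exacts [h l hl, h']
  have hDm (k : ℕ) : MeasurableSet {X : ℕ → Vertex | X k ∈ D} :=
    (measurable_pi_apply k) (MeasurableSet.of_discrete (s := D))
  have hTm (k : ℕ) : MeasurableSet {X : ℕ → Vertex | X k ∈ T} :=
    (measurable_pi_apply k) (MeasurableSet.of_discrete (s := T))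
  -- the chain does not stay in `D`
  have hB (k : ℕ) : ∫⁻ X in S (k + 1), φ (X (k + 1)) ∂P + P (S (k + 1)) ≤
      ∫⁻ X in S k, φ (X k) ∂P := by
    have h1 : P (S (k + 1)) = ∫⁻ _ in S (k + 1), 1 ∂P := by simp
    rw [lintegral_jumpChain_succ, h1, ← lintegral_add_right _ measurable_const]
    calc _ ≤ ∫⁻ X in S (k + 1), φ (X k) ∂P := by
          refine setLIntegral_mono (hm φ k) fun X hX => hφ _ (hX k (Nat.lt_succ_self k))
      _ ≤ _ := lintegral_mono_set (by rw [hSsucc]; exact Set.inter_subset_left)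
  -- Iterating the drift inequality bounds the sum of the survival probabilities by `φ x`, so they
  -- tend to zero.
  have hsum (k : ℕ) : ∑ j ∈ Finset.range k, P (S (j + 1)) + ∫⁻ X in S k, φ (X k) ∂P ≤ φ x := by
    induction k with
    | zero => simp [hS0, P, lintegral_jumpChain_zero]
    | succ k ih =>
      rw [Finset.sum_range_succ, add_assoc, add_comm (P _)]
      exact (add_le_add_right (hB k) _).trans ih
  have htend : Tendsto (fun k => P (S (k + 1))) atTop (𝓝 0) := by
    refine ENNReal.tendsto_atTop_zero_of_tsum_ne_top (ne_top_of_le_ne_top hφx ?_)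
    exact ENNReal.tsum_le_of_sum_range_le fun k => le_self_add.trans (hsum k)
  -- the telescoping sum
  have hE (k : ℕ) : ∫⁻ X in S k, g (X k) ∂P =
      P (S k ∩ {X | X k ∈ T}) + ∫⁻ X in S (k + 1), g (X (k + 1)) ∂P := by
    have h2 : ∫⁻ X in S (k + 1), ∫⁻ y, g y ∂jumpMeasure ω lam (X k) ∂P =
        ∫⁻ X in S (k + 1), g (X k) ∂P :=
      setLIntegral_congr_fun (hSm _) fun X hX => hg _ (hX k (Nat.lt_succ_self k))
    rw [lintegral_jumpChain_succ, h2, hSsucc,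
      -- Split according to whether the chain is still in `D` at time `k`; outside `D`, `g` is the
      -- indicator of `T`.
      ← lintegral_inter_add_sdiff (μ := P) (fun X => g (X k)) (S k) (hDm k), add_comm]
    congr 1
    rw [← setLIntegral_one, ← lintegral_indicator ((hSm k).diff (hDm k)),
      ← lintegral_indicator ((hSm k).inter (hTm k))]
    congr 1 with X
    by_cases hX : X ∈ S k
    · by_cases hD : X k ∈ D
      · have : X k ∉ T := fun hT => Set.disjoint_left.1 hDT hD hT
        simp [hD, this]
      · by_cases hT : X k ∈ T
        · simp [hX, hD, hT, hgT _ hT]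
        · simp [hX, hD, hT, hg0 _ hD hT]
    · simp [hX]
  have htel (k : ℕ) : g x = ∑ j ∈ Finset.range k, P (S j ∩ {X | X j ∈ T}) +
      ∫⁻ X in S k, g (X k) ∂P := by
    induction k with
    | zero => simp [hS0, P, lintegral_jumpChain_zero]
    | succ k ih => rw [ih, hE k, Finset.sum_range_succ, add_assoc]
  have hrest : Tendsto (fun k => ∫⁻ X in S (k + 1), g (X (k + 1)) ∂P) atTop (𝓝 0) := by
    refine tendsto_of_tendsto_of_tendsto_of_le_of_le tendsto_const_nhds htend
      (fun _ => zero_le) fun k => ?_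
    calc _ ≤ ∫⁻ _ in S (k + 1), 1 ∂P := lintegral_mono fun X => hg1 _
      _ = _ := by simp
  have hunion : {X : ℕ → Vertex | ∃ j, (∀ l < j, X l ∈ D) ∧ X j ∈ T} =
      ⋃ j, S j ∩ {X | X j ∈ T} := by
    ext X; simp [hS]
  have hdisj : Pairwise (Function.onFun Disjoint fun j => S j ∩ {X | X j ∈ T}) := by
    have aux : ∀ i j, i < j → Disjoint (S i ∩ {X | X i ∈ T}) (S j ∩ {X | X j ∈ T}) := by
      intro i j hij
      refine Set.disjoint_left.2 fun X h1 h2 => ?_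
      exact Set.disjoint_left.1 hDT (h2.1 i hij) h1.2
    intro i j hij
    rcases lt_or_gt_of_ne hij with h | h
    · exact aux i j h
    · exact (aux j i h).symm
  rw [hunion, measure_iUnion hdisj fun j => (hSm j).inter (hTm j)]
  have hlim := ((ENNReal.tendsto_nat_tsum fun j => P (S j ∩ {X | X j ∈ T})).comp
    (tendsto_add_atTop_nat 1)).add hrest
  rw [add_zero] at hlim
  refine tendsto_nhds_unique hlim ?_
  refine Tendsto.congr (fun k => htel (k + 1)) tendsto_const_nhds

/-! ### Conductances and the law of the exit position -/

/-- The escape probability of `v` in the tree truncated `k` levels below `v`, defined by its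
recursion. -/
noncomputable def conductance (ω : Tree) (lam : ℝ) : ℕ → Vertex → ℝ
  | 0, _ => 1
  | k + 1, v => (∑ i ∈ Finset.range (ω v), conductance ω lam k (i :: v)) /
      (lam + ∑ i ∈ Finset.range (ω v), conductance ω lam k (i :: v))

lemma conductance_nonneg (ω : Tree) {lam : ℝ} (hl : 0 < lam) (k : ℕ) (v : Vertex) :
    0 ≤ conductance ω lam k v := by
  induction k generalizing v with
  | zero => simp [conductance]
  | succ k ih =>
    have : 0 ≤ ∑ i ∈ Finset.range (ω v), conductance ω lam k (i :: v) :=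
      Finset.sum_nonneg fun i _ => ih _
    rw [conductance]
    positivity

lemma conductance_le_one (ω : Tree) {lam : ℝ} (hl : 0 < lam) (k : ℕ) (v : Vertex) :
    conductance ω lam k v ≤ 1 := by
  cases k with
  | zero => simp [conductance]
  | succ k =>
    have : 0 ≤ ∑ i ∈ Finset.range (ω v), conductance ω lam k (i :: v) :=
      Finset.sum_nonneg fun i _ => conductance_nonneg ω hl k _
    rw [conductance]
    exact div_le_one_of_le₀ (by linarith) (by linarith)

/-- The map `s ↦ s / (lam + s)` is increasing, so the inequality propagates up from the initial
value `1`. Monotonicity is what makes the limit exist. -/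
lemma conductance_succ_le (ω : Tree) {lam : ℝ} (hl : 0 < lam) (k : ℕ) (v : Vertex) :
    conductance ω lam (k + 1) v ≤ conductance ω lam k v := by
  induction k generalizing v with
  | zero => simpa [conductance] using conductance_le_one ω hl 1 v
  | succ k ih =>
    have h1 : ∑ i ∈ Finset.range (ω v), conductance ω lam (k + 1) (i :: v) ≤
        ∑ i ∈ Finset.range (ω v), conductance ω lam k (i :: v) :=
      Finset.sum_le_sum fun i _ => ih _
    have h0 : 0 ≤ ∑ i ∈ Finset.range (ω v), conductance ω lam (k + 1) (i :: v) :=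
      Finset.sum_nonneg fun i _ => conductance_nonneg ω hl _ _
    rw [conductance, conductance, div_le_div_iff₀ (by linarith) (by linarith)]
    nlinarith

lemma lintegral_jumpMeasure (ω : Tree) {lam : ℝ} (hl : 0 < lam) {v : Vertex} (hv : v ≠ [])
    {f : Vertex → ℝ} (hf : ∀ v, 0 ≤ f v) :
    ∫⁻ y, ENNReal.ofReal (f y) ∂jumpMeasure ω lam v =
      ENNReal.ofReal ((∑ i ∈ Finset.range (ω v), f (i :: v) + lam * f v.tail) / (ω v + lam)) := by
  have hrate : totalRate ω lam v = ENNReal.ofReal (ω v + lam) := by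
    unfold totalRate rateMeasure
    rw [if_neg hv, ENNReal.ofReal_add (by positivity) hl.le]
    simp
  have hpos : (0 : ℝ) < ω v + lam := by positivity
  rw [jumpMeasure, if_neg (by simpa [hrate] using hpos), hrate, rateMeasure, if_neg hv,
    lintegral_smul_measure, lintegral_add_measure, lintegral_finsetSum_measure,
    lintegral_smul_measure]
  simp only [lintegral_dirac, smul_eq_mul]
  rw [← ENNReal.ofReal_sum_of_nonneg (fun i _ => hf _), ← ENNReal.ofReal_mul hl.le,
    ← ENNReal.ofReal_add (Finset.sum_nonneg fun i _ => hf _) (mul_nonneg hl.le (hf _)),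
    div_eq_inv_mul, ENNReal.ofReal_mul (by positivity), ENNReal.ofReal_inv_of_pos hpos]

/-- The probability of hitting the root before level `n`. -/
noncomputable def returnProb (ω : Tree) (lam : ℝ) (n : ℕ) : Vertex → ℝ
  | [] => 1
  | i :: u => (1 - conductance ω lam (n - (u.length + 1)) (i :: u)) * returnProb ω lam n u

lemma returnProb_mem (ω : Tree) {lam : ℝ} (hl : 0 < lam) (n : ℕ) (v : Vertex) :
    0 ≤ returnProb ω lam n v ∧ returnProb ω lam n v ≤ 1 := by
  induction v with
  | nil => simp [returnProb]
  | cons i u ih =>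
    have h0 := conductance_nonneg ω hl (n - (u.length + 1)) (i :: u)
    have h1 := conductance_le_one ω hl (n - (u.length + 1)) (i :: u)
    rw [returnProb]
    exact ⟨mul_nonneg (by linarith) ih.1, mul_le_one₀ (by linarith) ih.1 ih.2⟩

/-- Truncated subtraction gives depth `0`, hence conductance `1`, at every level from `n` on. -/
lemma returnProb_of_le (ω : Tree) (lam : ℝ) {n : ℕ} {v : Vertex} (hv : v ≠ [])
    (hn : n ≤ v.length) : returnProb ω lam n v = 0 := by
  cases v with
  | nil => exact absurd rfl hv
  | cons i u =>
    rw [returnProb, Nat.sub_eq_zero_of_le (by simpa using hn)]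
    simp [conductance]

/-- A path to the root passes through every ancestor, so the return probability is a product along
the ancestral line. With the factor of the parent taken out, harmonicity is the conductance
recursion. -/
lemma returnProb_harmonic (ω : Tree) {lam : ℝ} (hl : 0 < lam) {n : ℕ} {v : Vertex} (hv : v ≠ [])
    (hn : v.length < n) :
    (∑ i ∈ Finset.range (ω v), returnProb ω lam n (i :: v) + lam * returnProb ω lam n v.tail) /
      (ω v + lam) = returnProb ω lam n v := by
  cases v with
  | nil => exact absurd rfl hv
  | cons j u =>
    obtain ⟨k, hk⟩ : ∃ k, n - (u.length + 1) = k + 1 :=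
      ⟨n - (u.length + 1) - 1, by simp at hn; omega⟩
    have hk' : n - ((j :: u).length + 1) = k := by simp; omega
    have hq : returnProb ω lam n (j :: u) =
        (1 - conductance ω lam (k + 1) (j :: u)) * returnProb ω lam n u := by
      rw [returnProb, hk]
    have hS0 : 0 ≤ ∑ i ∈ Finset.range (ω (j :: u)), conductance ω lam k (i :: j :: u) :=
      Finset.sum_nonneg fun i _ => conductance_nonneg ω hl k _
    have hsum : ∑ i ∈ Finset.range (ω (j :: u)), returnProb ω lam n (i :: j :: u) =
        (ω (j :: u) - ∑ i ∈ Finset.range (ω (j :: u)), conductance ω lam k (i :: j :: u)) *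
          returnProb ω lam n (j :: u) := by
      have : ∀ i, returnProb ω lam n (i :: j :: u) =
          (1 - conductance ω lam k (i :: j :: u)) * returnProb ω lam n (j :: u) := by
        intro i
        rw [returnProb, hk']
      simp_rw [this]
      rw [← Finset.sum_mul, Finset.sum_sub_distrib]
      simp
    rw [hsum, List.tail_cons, hq, conductance]
    set S := ∑ i ∈ Finset.range (ω (j :: u)), conductance ω lam k (i :: j :: u)
    have h1 : lam + S ≠ 0 := by positivity
    have h2 : (ω (j :: u) : ℝ) + lam ≠ 0 := by positivity
    field_simp
    ring

/-- Exit from `{v ≠ [], |v| < n}` through the root or through level `n`. -/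
theorem jumpChain_exit_level (ω : Tree) (hω : ∀ v, 1 ≤ ω v) {lam : ℝ} (hl : 0 < lam) {n : ℕ}
    (x : Vertex) (T : Set Vertex)
    (hT : ∀ v ∈ T, v = [] ∨ n ≤ v.length) (g : Vertex → ℝ) (hg : ∀ v, 0 ≤ g v ∧ g v ≤ 1)
    (hharm : ∀ v : Vertex, v ≠ [] → v.length < n →
      (∑ i ∈ Finset.range (ω v), g (i :: v) + lam * g v.tail) / (ω v + lam) = g v)
    (hgT : ∀ v ∈ T, g v = 1) (hg0 : ∀ v, (v = [] ∨ n ≤ v.length) → v ∉ T → g v = 0) :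
    jumpChain ω lam x {X | ∃ j, (∀ l < j, X l ∈ {v : Vertex | v ≠ [] ∧ v.length < n}) ∧ X j ∈ T} =
      ENNReal.ofReal (g x) := by
  -- An exponential in the height is needed, since the drift may point to the root. With `d ≥ 1`
  -- children and `A` the power at the parent's height, the mean decrease is `A (lam + 1) (d (lam +
  -- 2) - lam) / (d + lam) ≥ 1`.
  set φ : Vertex → ℝ := fun v => if v.length ≤ n then (lam + 2) ^ n - (lam + 2) ^ v.length else 0
    with hφ
  have hφ0 : ∀ v, 0 ≤ φ v := by
    intro v
    simp only [hφ]
    split_ifs with h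
    · exact sub_nonneg.2 (pow_le_pow_right₀ (by linarith) h)
    · exact le_rfl
  refine jumpChain_exit ω lam x _ T ?_ (fun v => ENNReal.ofReal (g v))
    (fun v => ENNReal.ofReal (φ v)) ?_ ?_ ?_ ?_ ENNReal.ofReal_ne_top ?_
  · refine Set.disjoint_left.2 fun v h1 h2 => ?_
    rcases hT v h2 with h | h
    · exact h1.1 h
    · exact absurd h1.2 (not_lt.2 h)
  · intro v
    simpa using (hg v).2
  · rintro v ⟨h1, h2⟩
    rw [lintegral_jumpMeasure ω hl h1 (fun v => (hg v).1), hharm v h1 h2]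
  · intro v hv
    simp [hgT v hv]
  · intro v hv hvT
    simp only [Set.mem_ofPred_eq, not_and_or, not_not, not_lt] at hv
    simp [hg0 v hv hvT]
  · rintro v ⟨h1, h2⟩
    rw [lintegral_jumpMeasure ω hl h1 hφ0, ← ENNReal.ofReal_one,
      ← ENNReal.ofReal_add (div_nonneg (add_nonneg (Finset.sum_nonneg fun i _ => hφ0 _)
        (mul_nonneg hl.le (hφ0 _))) (by positivity)) zero_le_one]
    refine ENNReal.ofReal_le_ofReal ?_
    obtain ⟨j, u, rfl⟩ := List.exists_cons_of_ne_nil h1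
    simp only [List.length_cons] at h2
    have e1 : ∀ i, φ (i :: j :: u) = (lam + 2) ^ n - (lam + 2) ^ (u.length + 2) := by
      intro i
      simp only [hφ, List.length_cons]
      rw [if_pos (by omega)]
    have e2 : φ (j :: u) = (lam + 2) ^ n - (lam + 2) ^ (u.length + 1) := by
      simp only [hφ, List.length_cons]
      rw [if_pos (by omega)]
    have e3 : φ u = (lam + 2) ^ n - (lam + 2) ^ u.length := by
      simp only [hφ]
      rw [if_pos (by omega)]
    simp only [e1, e2, e3, List.tail_cons, Finset.sum_const, Finset.card_range, nsmul_eq_mul]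
    have hd : (1 : ℝ) ≤ ω (j :: u) := by exact_mod_cast hω _
    set d : ℝ := ((ω (j :: u) : ℕ) : ℝ)
    set A := (lam + 2) ^ u.length with hA
    have hA1 : 1 ≤ A := one_le_pow₀ (by linarith)
    rw [div_add_one (by positivity), div_le_iff₀ (by positivity), pow_succ, pow_succ, ← hA]
    have h3 : d + lam ≤ (lam + 1) * (d * (lam + 2) - lam) := by
      nlinarith [mul_nonneg hl.le (sub_nonneg.2 hd),
        mul_nonneg (mul_nonneg hl.le hl.le) (sub_nonneg.2 hd)]
    have h4 : (lam + 1) * (d * (lam + 2) - lam) ≤ A * ((lam + 1) * (d * (lam + 2) - lam)) :=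
      le_mul_of_one_le_left ((by positivity : 0 ≤ d + lam).trans h3) hA1
    linarith

/-- The probability that the chain started at a child of the root hits level `n` before the
root. -/
theorem jumpChain_escape (ω : Tree) (hω : ∀ v, 1 ≤ ω v) {lam : ℝ} (hl : 0 < lam) {n : ℕ}
    (hn : 1 ≤ n) (i : ℕ) :
    jumpChain ω lam [i] {X | ∃ k, (X k).length = n ∧ ∀ j ≤ k, X j ≠ []} =
      ENNReal.ofReal (conductance ω lam (n - 1) [i]) := by
  set q := returnProb ω lam n with hq
  set g : Vertex → ℝ := fun v => if v.length ≤ n then 1 - q v else 0 with hg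
  have hqm := returnProb_mem ω hl n
  have hx : ([i] : Vertex).length ≤ n := by simpa using hn
  have hgi : g [i] = conductance ω lam (n - 1) [i] := by
    simp only [hg, if_pos hx, hq, returnProb]
    simp
  have hroot := jumpChain_exit_level ω hω hl (n := n) [i] {[]} (by simp) q hqm
    (fun v h1 h2 => returnProb_harmonic ω hl h1 h2) (by simp [hq, returnProb])
    (fun v h1 h2 => returnProb_of_le ω lam h2 (h1.resolve_left h2))
  have hlevel := jumpChain_exit_level ω hω hl (n := n) [i] {v | v.length = n}
    (by simp +contextual) g
    (by
      intro v
      simp only [hg]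
      split_ifs
      · constructor <;> linarith [(hqm v).1, (hqm v).2]
      · simp)
    (by
      intro v h1 h2
      have e1 : ∀ i, g (i :: v) = 1 - q (i :: v) := fun i => by
        simp only [hg, List.length_cons]; rw [if_pos (by omega)]
      have e2 : g v.tail = 1 - q v.tail := by
        simp only [hg, List.length_tail]; rw [if_pos (by omega)]
      have e3 : g v = 1 - q v := by
        simp only [hg]; rw [if_pos (by omega)]
      have h4 : (ω v : ℝ) + lam ≠ 0 := by positivity
      rw [e2, e3, hq, ← returnProb_harmonic ω hl h1 h2]
      simp only [e1, Finset.sum_sub_distrib, Finset.sum_const, Finset.card_range, nsmul_eq_mul]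
      field_simp
      ring)
    (by
      intro v hv
      have hv' : v.length = n := hv
      have : v ≠ [] := by rintro rfl; simp at hv'; omega
      simp only [hg, hv'.le, if_true, hq, returnProb_of_le ω lam this hv'.ge, sub_zero])
    (by
      intro v h1 h2
      have h2' : v.length ≠ n := h2
      rcases h1 with rfl | h1
      · simp [hg, hq, returnProb]
      · simp only [hg]; rw [if_neg (by omega)])
  rw [← hgi]
  -- The event contains the exit through level `n` and is disjoint from the exit through the root;
  -- the two bounds agree because `g [i] + q [i] = 1`.
  refine le_antisymm ?_ ?_
  · have hmeas : MeasurableSet {X : ℕ → Vertex | ∃ j,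
        (∀ l < j, X l ∈ {v : Vertex | v ≠ [] ∧ v.length < n}) ∧ X j ∈ ({[]} : Set Vertex)} := by
      have : {X : ℕ → Vertex | ∃ j,
        (∀ l < j, X l ∈ {v : Vertex | v ≠ [] ∧ v.length < n}) ∧ X j ∈ ({[]} : Set Vertex)} =
        ⋃ j, {X : ℕ → Vertex | ∀ l < j, X l ∈ {v : Vertex | v ≠ [] ∧ v.length < n}} ∩
          {X | X j ∈ ({[]} : Set Vertex)} := by
        ext X; simp
      rw [this]
      exact MeasurableSet.iUnion fun j => (measurableSet_stay _ j).inter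
        ((measurable_pi_apply j) (MeasurableSet.of_discrete (s := ({[]} : Set Vertex))))
    calc _ ≤ jumpChain ω lam [i] {X : ℕ → Vertex | ∃ j,
        (∀ l < j, X l ∈ {v : Vertex | v ≠ [] ∧ v.length < n}) ∧ X j ∈ ({[]} : Set Vertex)}ᶜ := by
          refine measure_mono ?_
          rintro X ⟨k, hk, hX⟩ ⟨j, hj, hj'⟩
          rcases lt_or_ge k j with h | h
          · exact absurd hk (hj k h).2.ne
          · exact hX j h hj'
      _ = 1 - ENNReal.ofReal (q [i]) := by rw [prob_compl_eq_one_sub hmeas, hroot]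
      _ = ENNReal.ofReal (g [i]) := by
          simp only [hg, if_pos hx]
          rw [ENNReal.ofReal_sub _ (hqm _).1, ENNReal.ofReal_one]
  · rw [← hlevel]
    refine measure_mono ?_
    rintro X ⟨j, hj, hj'⟩
    refine ⟨j, hj', fun l hl => ?_⟩
    rcases hl.lt_or_eq with h | rfl
    · exact (hj l h).1
    · have : (X l).length = n := hj'
      intro h0
      simp [h0] at this
      omega

/-! ### From the walk in continuous time to its jump chain -/

lemma totalRate_ne_zero (ω : Tree) (hω : ∀ v, 1 ≤ ω v) (lam : ℝ) (v : Vertex) :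
    totalRate ω lam v ≠ 0 := by
  have h : ω v ≠ 0 := by have := hω v; omega
  unfold totalRate rateMeasure
  simp [h]

lemma jumpTime_ne_top (ω : Tree) (hω : ∀ v, 1 ≤ ω v) (lam : ℝ) (η : (ℕ → Vertex) × (ℕ → ℝ))
    (n : ℕ) : jumpTime ω lam η n ≠ ⊤ := by
  unfold jumpTime
  refine ENNReal.sum_ne_top.2 fun k _ => ?_
  exact ENNReal.div_ne_top ENNReal.ofReal_ne_top (totalRate_ne_zero ω hω lam _)

lemma jumpTime_strictMono (ω : Tree) (hω : ∀ v, 1 ≤ ω v) (lam : ℝ)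
    {η : (ℕ → Vertex) × (ℕ → ℝ)} (hη : ∀ k, 0 < η.2 k) : StrictMono (jumpTime ω lam η) := by
  refine strictMono_nat_of_lt_succ fun n => ?_
  have h : jumpTime ω lam η (n + 1) = jumpTime ω lam η n +
      ENNReal.ofReal (η.2 n) / totalRate ω lam (η.1 n) := Finset.sum_range_succ _ _
  rw [h]
  refine ENNReal.lt_add_right (jumpTime_ne_top ω hω lam η n) ?_
  exact (ENNReal.div_pos (by simpa using hη n) (totalRate_ne_top ω lam _)).ne'

/-- Jump times increase strictly, so `t` lies in at most one holding interval and `Nat.find` has no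
choice. -/
lemma position_eq_some_iff (ω : Tree) (hω : ∀ v, 1 ≤ ω v) (lam : ℝ)
    {η : (ℕ → Vertex) × (ℕ → ℝ)} (hη : ∀ k, 0 < η.2 k) (t : ℝ≥0) (v : Vertex) :
    position ω lam η t = some v ↔ ∃ n, η.1 n = v ∧ jumpTime ω lam η n ≤ (t : ℝ≥0∞) ∧
      (t : ℝ≥0∞) < jumpTime ω lam η (n + 1) := by
  classical
  have hmono := jumpTime_strictMono ω hω lam hη
  unfold position
  constructor
  · intro h
    split_ifs at h with hex
    exact ⟨_, Option.some_injective _ h, Nat.find_spec hex⟩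
  · rintro ⟨n, rfl, hn⟩
    have hex : ∃ n, jumpTime ω lam η n ≤ (t : ℝ≥0∞) ∧ (t : ℝ≥0∞) < jumpTime ω lam η (n + 1) :=
      ⟨n, hn⟩
    rw [dif_pos hex]
    have hf := Nat.find_spec hex
    have h1 := hmono.lt_iff_lt.1 (hf.1.trans_lt hn.2)
    have h2 := hmono.lt_iff_lt.1 (hn.1.trans_lt hf.2)
    have : Nat.find hex = n := by omega
    rw [this]

/-- The order of the two hitting times is read off the order of the visits of the jump chain.
Explosion is harmless: the position `none` enters neither infimum. -/
lemma hitLevel_lt_hitVertex_iff (ω : Tree) (hω : ∀ v, 1 ≤ ω v) (lam : ℝ)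
    {η : (ℕ → Vertex) × (ℕ → ℝ)} (hη : ∀ k, 0 < η.2 k) (n : ℕ) (x : Vertex) :
    hitLevel ω lam n η < hitVertex ω lam x η ↔
      ∃ k, (η.1 k).length = n ∧ ∀ j ≤ k, η.1 j ≠ x := by
  have hmono := jumpTime_strictMono ω hω lam hη
  have hpos (k : ℕ) :
      position ω lam η (jumpTime ω lam η k).toNNReal = some (η.1 k) := by
    rw [position_eq_some_iff ω hω lam hη]
    refine ⟨k, rfl, ?_⟩
    rw [ENNReal.coe_toNNReal (jumpTime_ne_top ω hω lam η k)]
    exact ⟨le_rfl, hmono (Nat.lt_succ_self k)⟩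
  constructor
  · intro h
    simp only [hitLevel, iInf_lt_iff] at h
    obtain ⟨t, ⟨v, hv, hvn⟩, ht⟩ := h
    obtain ⟨k, rfl, hk⟩ := (position_eq_some_iff ω hω lam hη t v).1 hv
    refine ⟨k, hvn, fun j hj hjx => ?_⟩
    have h1 : hitVertex ω lam x η ≤ ((jumpTime ω lam η j).toNNReal : ℝ≥0∞) :=
      iInf₂_le _ (by rw [hpos, hjx])
    rw [ENNReal.coe_toNNReal (jumpTime_ne_top ω hω lam η j)] at h1
    exact absurd ht (not_lt.2 (h1.trans ((hmono.monotone hj).trans hk.1)))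
  · rintro ⟨k, hk, hkx⟩
    have h1 : hitLevel ω lam n η ≤ ((jumpTime ω lam η k).toNNReal : ℝ≥0∞) :=
      iInf₂_le _ ⟨_, hpos k, hk⟩
    rw [ENNReal.coe_toNNReal (jumpTime_ne_top ω hω lam η k)] at h1
    -- The vertex `x` can be visited only from jump `k + 1` on; the gap between consecutive jump
    -- times makes the inequality strict, even if `x` is never hit.
    refine h1.trans_lt ((hmono (Nat.lt_succ_self k)).trans_le ?_)
    refine le_iInf₂ fun t ht => ?_
    obtain ⟨j, hj, hj'⟩ := (position_eq_some_iff ω hω lam hη t x).1 ht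
    have : k < j := by
      by_contra hlt
      exact hkx j (not_lt.1 hlt) hj
    exact (hmono.monotone this).trans hj'.1

lemma ae_pos_infinitePi_exp :
    ∀ᵐ e ∂(Measure.infinitePi fun _ : ℕ => expMeasure 1), ∀ k, 0 < e k := by
  rw [ae_all_iff]
  intro k
  have h : ∀ᵐ x ∂(expMeasure 1), 0 < x := by
    rw [ae_iff]
    simp only [not_lt]
    have h0 : {a : ℝ | a ≤ 0} = Set.Iic 0 := rfl
    rw [h0, ← ofReal_cdf, cdf_expMeasure_eq one_pos]
    simp
  exact (measurePreserving_eval_infinitePi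
    (fun _ : ℕ => expMeasure 1) k).quasiMeasurePreserving.ae h

theorem escapeBefore_eq_conductance (ω : Tree) (hω : ∀ v, 1 ≤ ω v) {lam : ℝ} (hl : 0 < lam)
    {n : ℕ} (hn : 1 ≤ n) (i : ℕ) :
    escapeBefore ω lam n [i] = conductance ω lam (n - 1) [i] := by
  unfold escapeBefore
  set E : Set (ℕ → Vertex) := {X | ∃ k, (X k).length = n ∧ ∀ j ≤ k, X j ≠ []}
  have hae : ∀ᵐ η ∂(walkLaw ω lam [i]), ∀ k, 0 < η.2 k :=
    (Measure.quasiMeasurePreserving_snd (μ := jumpChain ω lam [i])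
      (ν := Measure.infinitePi fun _ : ℕ => expMeasure 1)).ae ae_pos_infinitePi_exp
  have hcongr : {η | hitLevel ω lam n η < hitVertex ω lam ([i] : Vertex).tail η}
      =ᵐ[walkLaw ω lam [i]] (E ×ˢ Set.univ : Set ((ℕ → Vertex) × (ℕ → ℝ))) := by
    filter_upwards [hae] with η hη
    refine propext ?_
    have := hitLevel_lt_hitVertex_iff ω hω lam hη n ([i] : Vertex).tail
    change η ∈ {η | hitLevel ω lam n η < hitVertex ω lam ([i] : Vertex).tail η} ↔
      η ∈ E ×ˢ Set.univ
    rw [Set.mem_ofPred_eq, this, Set.mem_prod]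
    simp [E]
  rw [measureReal_congr hcongr, measureReal_def, walkLaw, Measure.prod_prod,
    jumpChain_escape ω hω hl hn i, measure_univ, mul_one,
    ENNReal.toReal_ofReal (conductance_nonneg ω hl _ _)]

theorem escapeBeforeRoot_eq_conductance (ω : Tree) (hω : ∀ v, 1 ≤ ω v) {lam : ℝ} (hl : 0 < lam)
    (n : ℕ) : escapeBeforeRoot ω lam (n + 1) = conductance ω lam (n + 1) [] := by
  rw [escapeBeforeRoot, conductance]
  simp only [escapeBefore_eq_conductance ω hω hl (Nat.succ_pos n), Nat.succ_sub_one]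

/-! ### The branching property -/

/-- The tree of descendants of the child `i` of the root. -/
def subtree (ω : Tree) (i : ℕ) : Tree := fun v => ω (v ++ [i])

/-- The tree with `d` children of the root and subtrees given by `t`. -/
def graft (q : ℕ × (ℕ × Vertex → ℕ)) : Tree := fun v =>
  if h : v = [] then q.1 else q.2 (v.getLast h, v.dropLast)

lemma measurable_graft : Measurable graft := by
  refine measurable_pi_lambda _ fun v => ?_
  unfold graft
  split_ifs
  · exact measurable_fst
  · exact (measurable_pi_apply _).comp measurable_snd

/-- Nonempty words correspond bijectively to pairs of a last letter (the child of the root above the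
vertex) and the remaining word. A cylinder therefore pulls back to a root condition times a cylinder
over pairs. -/
lemma map_graft (p : PMF ℕ) :
    (p.toMeasure.prod (Measure.infinitePi fun _ : ℕ × Vertex => p.toMeasure)).map graft =
      galtonWatson p := by
  classical
  refine Measure.eq_infinitePi _ fun s t ht => ?_
  have hinj : Function.Injective fun x : ℕ × Vertex => x.2 ++ [x.1] := by
    rintro ⟨i, v⟩ ⟨j, w⟩ h
    have := List.append_inj' h rfl
    simp_all
  set s' := s.preimage (fun x : ℕ × Vertex => x.2 ++ [x.1]) hinj.injOn with hs'
  rw [Measure.map_apply measurable_graft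
    (MeasurableSet.pi s.countable_toSet fun _ _ => ht _)]
  have hpre : graft ⁻¹' (s : Set Vertex).pi t =
      (if [] ∈ s then t [] else Set.univ) ×ˢ
        (s' : Set (ℕ × Vertex)).pi (fun x => t (x.2 ++ [x.1])) := by
    ext ⟨d, u⟩
    simp only [Set.mem_preimage, Set.mem_pi, Finset.mem_coe, Set.mem_prod]
    constructor
    · intro h
      refine ⟨?_, fun x hx => ?_⟩
      · split_ifs with h0
        · simpa [graft] using h [] h0
        · trivial
      · have := h _ (Finset.mem_preimage.1 hx)
        simpa [graft] using this
    · rintro ⟨h1, h2⟩ v hv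
      rcases List.eq_nil_or_concat' v with rfl | ⟨w, i, rfl⟩
      · simpa [graft, hv] using h1
      · have := h2 (i, w) (Finset.mem_preimage.2 hv)
        simpa [graft] using this
  rw [hpre, Measure.prod_prod, Measure.infinitePi_pi _ fun _ _ => ht _]
  have h1 : ∏ x ∈ s', p.toMeasure (t (x.2 ++ [x.1])) = ∏ v ∈ s with v ≠ [], p.toMeasure (t v) := by
    have := Finset.prod_preimage' (fun x : ℕ × Vertex => x.2 ++ [x.1]) s hinj.injOn
      (fun v => p.toMeasure (t v))
    rw [hs', this]
    congr 1
    ext v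
    simp only [Finset.mem_filter, Set.mem_range, Prod.exists, and_congr_right_iff]
    intro _
    constructor
    · rintro ⟨i, w, rfl⟩; simp
    · intro hv
      rcases List.eq_nil_or_concat' v with rfl | ⟨w, i, rfl⟩
      · exact absurd rfl hv
      · exact ⟨i, w, rfl⟩
  rw [h1, ← Finset.prod_filter_mul_prod_filter_not s (fun v => v = [])]
  congr 1
  rw [Finset.prod_filter, Finset.prod_ite_eq' s ([] : Vertex)]
  split_ifs <;> simp

/-- The law of the independent subtrees below the possible children of the root. -/
noncomputable def subtreesLaw (p : PMF ℕ) : Measure (ℕ → Tree) :=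
  Measure.infinitePi fun _ : ℕ => galtonWatson p

instance instIsProbabilityMeasureSubtreesLaw (p : PMF ℕ) :
    IsProbabilityMeasure (subtreesLaw p) := by
  unfold subtreesLaw; infer_instance

/-- The number of children of the root is independent of the subtrees below them, and these are
independent Galton–Watson trees. -/
theorem measurePreserving_branching (p : PMF ℕ) :
    MeasurePreserving (fun ω : Tree => (ω [], subtree ω)) (galtonWatson p)
      (p.toMeasure.prod (subtreesLaw p)) := by
  have hm : Measurable fun ω : Tree => (ω [], subtree ω) := by
    refine (measurable_pi_apply _).prodMk (measurable_pi_lambda _ fun i =>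
      measurable_pi_lambda _ fun v => measurable_pi_apply _)
  refine ⟨hm, ?_⟩
  rw [← map_graft, Measure.map_map hm measurable_graft]
  -- Pulled back along `graft`, the decomposition at the root is mere currying, which preserves
  -- infinite products.
  have hcomp : (fun ω : Tree => (ω [], subtree ω)) ∘ graft =
      Prod.map id (MeasurableEquiv.curry ℕ Vertex ℕ) := by
    funext q
    refine Prod.ext ?_ ?_
    · simp [graft]
    · funext i v
      simp [graft, subtree]
  rw [hcomp, ← Measure.map_prod_map _ _ measurable_id (MeasurableEquiv.measurable _),
    Measure.map_id]
  congr 1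
  exact Measure.infinitePi_map_curry (fun _ _ => p.toMeasure)

lemma measurePreserving_root (p : PMF ℕ) :
    MeasurePreserving (fun ω : Tree => ω []) (galtonWatson p) p.toMeasure :=
  measurePreserving_eval_infinitePi (fun _ : Vertex => p.toMeasure) []

lemma measurePreserving_subtrees_eval (p : PMF ℕ) (i : ℕ) :
    MeasurePreserving (fun t : ℕ → Tree => t i) (subtreesLaw p) (galtonWatson p) :=
  measurePreserving_eval_infinitePi (fun _ : ℕ => galtonWatson p) i

lemma measurePreserving_subtree (p : PMF ℕ) (i : ℕ) :
    MeasurePreserving (fun ω : Tree => subtree ω i) (galtonWatson p) (galtonWatson p) :=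
  (measurePreserving_subtrees_eval p i).comp
    (measurePreserving_snd.comp (measurePreserving_branching p))

/-! ### Moments of sums over the children of the root -/

lemma integrable_toMeasure_of_summable (p : PMF ℕ) {f : ℕ → ℝ} (hf : ∀ k, 0 ≤ f k)
    (hs : Summable fun k => f k * (p k).toReal) : Integrable f p.toMeasure := by
  refine ⟨(measurable_of_countable f).aestronglyMeasurable, ?_⟩
  rw [hasFiniteIntegral_iff_ofReal (Eventually.of_forall hf), lintegral_countable']
  have : ∀ k, ENNReal.ofReal (f k) * p.toMeasure {k} = ENNReal.ofReal (f k * (p k).toReal) := by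
    intro k
    rw [p.toMeasure_apply_singleton k (measurableSet_singleton k), ENNReal.ofReal_mul (hf k),
      ENNReal.ofReal_toReal (p.apply_ne_top k)]
  simp_rw [this]
  exact hs.tsum_ofReal_lt_top

/-- The only use of the exponential moment; a second moment suffices from here on. -/
lemma integrable_sq_offspring (p : PMF ℕ)
    (hexp : ∃ b : ℝ, 1 < b ∧ Summable fun k : ℕ => b ^ k * (p k).toReal) :
    Integrable (fun k : ℕ => (k : ℝ) ^ 2) p.toMeasure := by
  obtain ⟨b, hb, hs⟩ := hexp
  refine integrable_toMeasure_of_summable p (fun k => by positivity) ?_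
  refine summable_of_isBigO_nat hs ?_
  exact (isLittleO_pow_const_const_pow_of_one_lt 2 hb).isBigO.mul (Asymptotics.isBigO_refl _ _)

lemma integrable_offspring {p : PMF ℕ}
    (hp : Integrable (fun k : ℕ => (k : ℝ) ^ 2) p.toMeasure) :
    Integrable (fun k : ℕ => (k : ℝ)) p.toMeasure := by
  refine hp.mono' (measurable_of_countable _).aestronglyMeasurable
    (Eventually.of_forall fun k => ?_)
  rw [Real.norm_natCast]
  exact_mod_cast Nat.le_self_pow two_ne_zero k

lemma mean_eq_integral {p : PMF ℕ} (hp : Integrable (fun k : ℕ => (k : ℝ) ^ 2) p.toMeasure) :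
    mean p = ∫ k : ℕ, (k : ℝ) ∂p.toMeasure := by
  rw [PMF.integral_eq_tsum _ _ (integrable_offspring hp), mean]
  simp [mul_comm]

lemma secondMoment_eq_integral {p : PMF ℕ}
    (hp : Integrable (fun k : ℕ => (k : ℝ) ^ 2) p.toMeasure) :
    secondMoment p = ∫ k : ℕ, (k : ℝ) ^ 2 ∂p.toMeasure := by
  rw [PMF.integral_eq_tsum _ _ hp, secondMoment]
  simp [mul_comm]

/-- The sum of `F` over the subtrees below the children of the root. -/
noncomputable def subtreeSum (F : Tree → ℝ) (ω : Tree) : ℝ :=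
  ∑ i ∈ Finset.range (ω []), F (subtree ω i)

/-- Allows passing to measurable representatives: `escapeRoot` and `limitW` are controlled only
almost everywhere. -/
lemma subtreeSum_congr {p : PMF ℕ} {F G : Tree → ℝ} (h : F =ᵐ[galtonWatson p] G) :
    subtreeSum F =ᵐ[galtonWatson p] subtreeSum G := by
  have : ∀ᵐ ω ∂(galtonWatson p), ∀ i, F (subtree ω i) = G (subtree ω i) :=
    ae_all_iff.2 fun i => (measurePreserving_subtree p i).quasiMeasurePreserving.ae h
  filter_upwards [this] with ω hω
  simp [subtreeSum, hω]

lemma measurable_rangeSum {F : Tree → ℝ} (hF : Measurable F) :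
    Measurable fun q : ℕ × (ℕ → Tree) => ∑ i ∈ Finset.range q.1, F (q.2 i) := by
  refine measurable_from_prod_countable_right fun k => ?_
  exact Finset.measurable_sum (Finset.range k) fun i _ => hF.comp (measurable_pi_apply i)

lemma subtreeSum_of_measurable {p : PMF ℕ} {F : Tree → ℝ} (hF : Measurable F) :
    Measurable (subtreeSum F) :=
  (measurable_rangeSum hF).comp (measurePreserving_branching p).measurable

/-- Wald's identity: the number of summands is independent of the identically distributed summands.
-/
theorem integrable_subtreeSum {p : PMF ℕ}
    (hp : Integrable (fun k : ℕ => (k : ℝ) ^ 2) p.toMeasure) {F : Tree → ℝ}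
    (hF : Integrable F (galtonWatson p)) :
    Integrable (subtreeSum F) (galtonWatson p) ∧
      ∫ ω, subtreeSum F ω ∂(galtonWatson p) = mean p * ∫ ω, F ω ∂(galtonWatson p) := by
  wlog hFm : Measurable F generalizing F
  · have hmk := hF.1.ae_eq_mk
    obtain ⟨h1, h2⟩ := this (hF.congr hmk) hF.1.stronglyMeasurable_mk.measurable
    have h3 := subtreeSum_congr hmk
    exact ⟨h1.congr h3.symm, by rw [integral_congr_ae h3, h2, integral_congr_ae hmk]⟩
  have hb := measurePreserving_branching p
  set H : ℕ × (ℕ → Tree) → ℝ := fun q => ∑ i ∈ Finset.range q.1, F (q.2 i) with hH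
  have hHm : AEStronglyMeasurable H (p.toMeasure.prod (subtreesLaw p)) :=
    (measurable_rangeSum hFm).aestronglyMeasurable
  have hFi (i : ℕ) : Integrable (fun t : ℕ → Tree => F (t i)) (subtreesLaw p) :=
    (measurePreserving_subtrees_eval p i).integrable_comp_of_integrable hF
  have hFe (i : ℕ) (G : Tree → ℝ) (hG : Measurable G) :
      ∫ t : ℕ → Tree, G (t i) ∂subtreesLaw p = ∫ ω, G ω ∂galtonWatson p := by
    rw [← (measurePreserving_subtrees_eval p i).map_eq, integral_map
      (measurable_pi_apply i).aemeasurable hG.aestronglyMeasurable]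
  have hint : Integrable H (p.toMeasure.prod (subtreesLaw p)) := by
    rw [integrable_prod_iff hHm]
    refine ⟨Eventually.of_forall fun k =>
      integrable_finsetSum (Finset.range k) fun i _ => hFi i, ?_⟩
    refine ((integrable_offspring hp).mul_const (∫ ω, ‖F ω‖ ∂galtonWatson p)).mono'
      (measurable_of_countable _).aestronglyMeasurable (Eventually.of_forall fun k => ?_)
    rw [Real.norm_of_nonneg (integral_nonneg fun _ => norm_nonneg _)]
    calc _ ≤ ∫ t, ∑ i ∈ Finset.range k, ‖F (t i)‖ ∂subtreesLaw p :=
          integral_mono_of_nonneg (Eventually.of_forall fun _ => norm_nonneg _)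
            (integrable_finsetSum _ fun i _ => (hFi i).norm)
            (Eventually.of_forall fun t => norm_sum_le _ _)
      _ = _ := by
          rw [integral_finsetSum _ fun i _ => (hFi i).norm]
          simp_rw [hFe _ _ hFm.norm]
          simp
  have hcomp : subtreeSum F = H ∘ fun ω : Tree => (ω [], subtree ω) := rfl
  refine ⟨hcomp ▸ hb.integrable_comp_of_integrable hint, ?_⟩
  have h1 : ∫ ω, subtreeSum F ω ∂(galtonWatson p) =
      ∫ q, H q ∂(p.toMeasure.prod (subtreesLaw p)) := by
    rw [← hb.map_eq, integral_map hb.measurable.aemeasurable (hb.map_eq.symm ▸ hHm)]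
    rfl
  rw [h1, integral_prod _ hint, mean_eq_integral hp, ← integral_mul_const]
  congr 1 with k
  simp only [hH]
  rw [integral_finsetSum _ fun i _ => hFi i]
  simp_rw [hFe _ _ hFm]
  simp

/-- Given `k` children, the sum has mean `k a` and variance `k (s - a²)`, with `a` and `s` the first
two moments of `F`. For centred `F` the last term drops, and division by `mean p` yields the
contraction factor `1/m`. -/
theorem memLp_subtreeSum {p : PMF ℕ}
    (hp : Integrable (fun k : ℕ => (k : ℝ) ^ 2) p.toMeasure) {F : Tree → ℝ}
    (hF : MemLp F 2 (galtonWatson p)) :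
    MemLp (subtreeSum F) 2 (galtonWatson p) ∧
      ∫ ω, subtreeSum F ω ^ 2 ∂(galtonWatson p) = mean p * ∫ ω, F ω ^ 2 ∂(galtonWatson p) +
        (secondMoment p - mean p) * (∫ ω, F ω ∂(galtonWatson p)) ^ 2 := by
  wlog hFm : Measurable F generalizing F
  · have hmk := hF.1.ae_eq_mk
    obtain ⟨h1, h2⟩ := this ((memLp_congr_ae hmk).1 hF) hF.1.stronglyMeasurable_mk.measurable
    have h3 := subtreeSum_congr hmk
    refine ⟨(memLp_congr_ae h3).2 h1, ?_⟩
    have h4 : (fun ω => subtreeSum F ω ^ 2) =ᵐ[galtonWatson p]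
        fun ω => subtreeSum (hF.1.mk F) ω ^ 2 := h3.fun_comp (· ^ 2)
    have h5 : (fun ω => F ω ^ 2) =ᵐ[galtonWatson p] fun ω => hF.1.mk F ω ^ 2 :=
      hmk.fun_comp (· ^ 2)
    rw [integral_congr_ae h4, integral_congr_ae h5, integral_congr_ae hmk]
    exact h2
  have hb := measurePreserving_branching p
  set H : ℕ × (ℕ → Tree) → ℝ := fun q => ∑ i ∈ Finset.range q.1, F (q.2 i) with hH
  have hHmeas : Measurable H := measurable_rangeSum hFm
  have hHm : AEStronglyMeasurable (fun q => H q ^ 2) (p.toMeasure.prod (subtreesLaw p)) :=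
    (hHmeas.pow_const 2).aestronglyMeasurable
  have hFi (i : ℕ) : MemLp (fun t : ℕ → Tree => F (t i)) 2 (subtreesLaw p) :=
    hF.comp_measurePreserving (measurePreserving_subtrees_eval p i)
  have hsumL (k : ℕ) : MemLp (fun t : ℕ → Tree => ∑ i ∈ Finset.range k, F (t i)) 2
      (subtreesLaw p) := memLp_finsetSum _ fun i _ => hFi i
  have hFe (i : ℕ) (G : Tree → ℝ) (hG : Measurable G) :
      ∫ t : ℕ → Tree, G (t i) ∂subtreesLaw p = ∫ ω, G ω ∂galtonWatson p := by
    rw [← (measurePreserving_subtrees_eval p i).map_eq, integral_map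
      (measurable_pi_apply i).aemeasurable hG.aestronglyMeasurable]
  have hindep : iIndepFun (fun i (t : ℕ → Tree) => F (t i)) (subtreesLaw p) :=
    iIndepFun_infinitePi fun _ => hFm
  set a := ∫ ω, F ω ∂(galtonWatson p) with ha
  set s := ∫ ω, F ω ^ 2 ∂(galtonWatson p) with hs
  have hk (k : ℕ) : ∫ t, H (k, t) ^ 2 ∂subtreesLaw p = k * s + ((k : ℝ) ^ 2 - k) * a ^ 2 := by
    have h1 := IndepFun.variance_sum (s := Finset.range k) (fun i _ => hFi i)
      (fun i _ j _ hij => hindep.indepFun hij)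
    have h2 : (∑ i ∈ Finset.range k, fun t : ℕ → Tree => F (t i)) = fun t => H (k, t) := by
      ext t; simp [hH]
    have h3 (i : ℕ) : Var[fun t : ℕ → Tree => F (t i); subtreesLaw p] = s - a ^ 2 := by
      rw [variance_eq_sub (hFi i)]
      simp only [Pi.pow_apply]
      rw [hFe i (fun ω => F ω ^ 2) (hFm.pow_const 2), hFe i F hFm]
    have h4 : ∫ t, H (k, t) ∂subtreesLaw p = k * a := by
      simp only [hH]
      rw [integral_finsetSum _ fun i _ => (hFi i).integrable one_le_two]
      simp_rw [hFe _ _ hFm]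
      simp [ha]
    rw [h2, variance_eq_sub (hsumL k)] at h1
    simp only [h3, Finset.sum_const, Finset.card_range, nsmul_eq_mul, Pi.pow_apply] at h1
    change ∫ t, H (k, t) ^ 2 ∂subtreesLaw p - (∫ t, H (k, t) ∂subtreesLaw p) ^ 2 = _ at h1
    rw [h4] at h1
    linarith
  have hint : Integrable (fun q => H q ^ 2) (p.toMeasure.prod (subtreesLaw p)) := by
    rw [integrable_prod_iff hHm]
    refine ⟨Eventually.of_forall fun k => (hsumL k).integrable_sq, ?_⟩
    simp only [norm_pow, Real.norm_eq_abs, sq_abs, hk]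
    exact ((integrable_offspring hp).mul_const s).add
      ((hp.sub (integrable_offspring hp)).mul_const (a ^ 2))
  have h0 : MemLp H 2 (p.toMeasure.prod (subtreesLaw p)) :=
    (memLp_two_iff_integrable_sq hHmeas.aestronglyMeasurable).2 hint
  refine ⟨h0.comp_measurePreserving hb, ?_⟩
  have h1 : ∫ ω, subtreeSum F ω ^ 2 ∂(galtonWatson p) =
      ∫ q, H q ^ 2 ∂(p.toMeasure.prod (subtreesLaw p)) := by
    rw [← hb.map_eq, integral_map hb.measurable.aemeasurable (hb.map_eq.symm ▸ hHm)]
    rfl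
  rw [h1, integral_prod _ hint, mean_eq_integral hp, secondMoment_eq_integral hp]
  have hd : Integrable (fun k : ℕ => (k : ℝ) ^ 2 - k) p.toMeasure :=
    hp.sub (integrable_offspring hp)
  simp_rw [hk]
  rw [integral_add ((integrable_offspring hp).mul_const s) (hd.mul_const (a ^ 2)),
    integral_mul_const, integral_mul_const, integral_sub hp (integrable_offspring hp)]

/-! ### The Galton–Watson martingale -/

lemma isVertex_append_singleton (ω : Tree) (v : Vertex) (i : ℕ) :
    IsVertex ω (v ++ [i]) ↔ i < ω [] ∧ IsVertex (subtree ω i) v := by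
  induction v with
  | nil => simp [IsVertex]
  | cons j v ih =>
    rw [List.cons_append, IsVertex, IsVertex, ih]
    simp only [subtree]
    tauto

/-- The vertices of generation `n`. -/
noncomputable def generation : ℕ → Tree → Finset Vertex
  | 0, _ => {[]}
  | n + 1, ω => (Finset.range (ω [])).biUnion fun i =>
      (generation n (subtree ω i)).image fun v => v ++ [i]

lemma coe_generation (n : ℕ) (ω : Tree) :
    (generation n ω : Set Vertex) = {v | IsVertex ω v ∧ v.length = n} := by
  induction n generalizing ω with
  | zero =>
    ext v
    simp only [generation, Finset.coe_singleton, Set.mem_singleton_iff, Set.mem_ofPred_eq,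
      List.length_eq_zero_iff]
    exact ⟨by rintro rfl; exact ⟨trivial, rfl⟩, fun h => h.2⟩
  | succ n ih =>
    ext v
    have ih' (i : ℕ) (w : Vertex) : w ∈ generation n (subtree ω i) ↔
        IsVertex (subtree ω i) w ∧ w.length = n := by
      rw [← Finset.mem_coe, ih]; rfl
    simp only [generation, Finset.coe_biUnion, Finset.coe_range, Finset.coe_image, Set.mem_iUnion,
      Set.mem_image, Finset.mem_coe, ih', Set.mem_Iio, Set.mem_ofPred_eq]
    constructor
    · rintro ⟨i, hi, w, ⟨hw, hl⟩, rfl⟩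
      exact ⟨(isVertex_append_singleton ω w i).2 ⟨hi, hw⟩, by simp [hl]⟩
    · rintro ⟨hv, hl⟩
      rcases List.eq_nil_or_concat' v with rfl | ⟨w, i, rfl⟩
      · simp at hl
      · obtain ⟨hi, hw⟩ := (isVertex_append_singleton ω w i).1 hv
        exact ⟨i, hi, w, ⟨hw, by simpa using hl⟩, rfl⟩

lemma generationSize_eq_card (ω : Tree) (n : ℕ) : generationSize ω n = (generation n ω).card := by
  rw [generationSize, ← coe_generation, Set.ncard_coe_finset]

lemma generationSize_succ (ω : Tree) (n : ℕ) :
    generationSize ω (n + 1) = ∑ i ∈ Finset.range (ω []), generationSize (subtree ω i) n := by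
  simp only [generationSize_eq_card]
  rw [generation, Finset.card_biUnion]
  · exact Finset.sum_congr rfl fun i _ =>
      Finset.card_image_of_injective _ fun v w h => List.append_cancel_right h
  · intro i _ j _ hij
    refine Finset.disjoint_left.2 fun v h1 h2 => hij ?_
    obtain ⟨w, -, rfl⟩ := Finset.mem_image.1 h1
    obtain ⟨w', -, h⟩ := Finset.mem_image.1 h2
    have := List.append_inj' h rfl
    simpa using this.2.symm

lemma martingaleW_zero (p : PMF ℕ) (ω : Tree) : martingaleW p ω 0 = 1 := by
  simp [martingaleW, generationSize_eq_card, generation]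

/-- Decomposition at the root rather than at the last generation, to match the recursion for the
escape probability. -/
lemma martingaleW_succ (p : PMF ℕ) (ω : Tree) (n : ℕ) :
    martingaleW p ω (n + 1) = subtreeSum (fun ω => martingaleW p ω n) ω / mean p := by
  simp only [martingaleW, subtreeSum, generationSize_succ, Nat.cast_sum]
  rw [← Finset.sum_div, pow_succ, div_div]

lemma memLp_martingaleW {p : PMF ℕ}
    (hp : Integrable (fun k : ℕ => (k : ℝ) ^ 2) p.toMeasure)
    (n : ℕ) : MemLp (fun ω => martingaleW p ω n) 2 (galtonWatson p) := by
  induction n with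
  | zero => simpa only [martingaleW_zero] using memLp_const (1 : ℝ)
  | succ n ih =>
    simp only [martingaleW_succ, div_eq_inv_mul]
    exact (memLp_subtreeSum hp ih).1.const_mul _

lemma integral_martingaleW {p : PMF ℕ} (hm : 1 < mean p)
    (hp : Integrable (fun k : ℕ => (k : ℝ) ^ 2) p.toMeasure)
    (n : ℕ) : ∫ ω, martingaleW p ω n ∂(galtonWatson p) = 1 := by
  induction n with
  | zero => simp [martingaleW_zero]
  | succ n ih =>
    have h := (integrable_subtreeSum hp ((memLp_martingaleW hp n).integrable one_le_two)).2
    have hm0 : mean p ≠ 0 := by linarith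
    simp only [martingaleW_succ, integral_div]
    rw [h, ih]
    field_simp

lemma secondMoment_nonneg_sub {p : PMF ℕ}
    (hp : Integrable (fun k : ℕ => (k : ℝ) ^ 2) p.toMeasure) : 0 ≤ secondMoment p - mean p := by
  rw [secondMoment_eq_integral hp, mean_eq_integral hp,
    ← integral_sub hp (integrable_offspring hp)]
  refine integral_nonneg fun k => ?_
  have : (k : ℝ) ≤ (k : ℝ) ^ 2 := by exact_mod_cast Nat.le_self_pow two_ne_zero k
  simpa using this

lemma integral_sq_martingaleW_le {p : PMF ℕ} (hm : 1 < mean p)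
    (hp : Integrable (fun k : ℕ => (k : ℝ) ^ 2) p.toMeasure) : ∃ K : ℝ, 0 < K ∧
    ∀ n, ∫ ω, martingaleW p ω n ^ 2 ∂(galtonWatson p) ≤ K := by
  have hm0 : (0 : ℝ) < mean p := by linarith
  have hs := secondMoment_nonneg_sub hp
  set s := secondMoment p - mean p with hsdef
  -- The second moments obey `x ↦ x / m + s / m²`, with fixed point `s / (m (m - 1))`; the extra `1`
  -- covers the initial value.
  refine ⟨1 + s / (mean p * (mean p - 1)),
    add_pos_of_pos_of_nonneg one_pos (div_nonneg hs (mul_nonneg hm0.le (by linarith))), ?_⟩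
  have hm1 : (0 : ℝ) < mean p - 1 := by linarith
  intro n
  induction n with
  | zero =>
    simp only [martingaleW_zero]
    simp only [one_pow, integral_const, probReal_univ, smul_eq_mul, mul_one]
    linarith [div_nonneg hs (mul_nonneg hm0.le hm1.le)]
  | succ n ih =>
    simp only [martingaleW_succ, div_pow, integral_div]
    rw [(memLp_subtreeSum hp (memLp_martingaleW hp n)).2, integral_martingaleW hm hp,
      ← hsdef, div_le_iff₀ (by positivity)]
    calc _ ≤ mean p * (1 + s / (mean p * (mean p - 1))) + s * 1 ^ 2 := by gcongr
      _ ≤ _ := by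
        have e : (1 + s / (mean p * (mean p - 1))) * mean p ^ 2 -
            (mean p * (1 + s / (mean p * (mean p - 1))) + s * 1 ^ 2) =
            mean p * (mean p - 1) := by
          field_simp
          ring
        nlinarith [mul_pos hm0 hm1]

/-- Differences of martingale values are centred, so each branching step contributes a factor `1/m`.
-/
lemma integral_sq_martingaleW_sub {p : PMF ℕ} (hm : 1 < mean p)
    (hp : Integrable (fun k : ℕ => (k : ℝ) ^ 2) p.toMeasure)
    (n i j : ℕ) :
    ∫ ω, (martingaleW p ω (n + i) - martingaleW p ω (n + j)) ^ 2 ∂(galtonWatson p) =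
      (mean p)⁻¹ ^ n * ∫ ω, (martingaleW p ω i - martingaleW p ω j) ^ 2 ∂(galtonWatson p) := by
  induction n with
  | zero => simp
  | succ n ih =>
    have hL : MemLp (fun ω => martingaleW p ω (n + i) - martingaleW p ω (n + j)) 2
      (galtonWatson p) := (memLp_martingaleW hp _).sub (memLp_martingaleW hp _)
    have h0 : ∫ ω, (martingaleW p ω (n + i) - martingaleW p ω (n + j)) ∂(galtonWatson p) = 0 := by
      rw [integral_sub ((memLp_martingaleW hp _).integrable one_le_two)
        ((memLp_martingaleW hp _).integrable one_le_two), integral_martingaleW hm hp,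
        integral_martingaleW hm hp, sub_self]
    have hsum (ω : Tree) : martingaleW p ω (n + 1 + i) - martingaleW p ω (n + 1 + j) =
        subtreeSum (fun ω => martingaleW p ω (n + i) - martingaleW p ω (n + j)) ω / mean p := by
      rw [Nat.add_right_comm n 1 i, Nat.add_right_comm n 1 j, martingaleW_succ, martingaleW_succ,
        ← sub_div]
      simp [subtreeSum, Finset.sum_sub_distrib]
    have hm0 : mean p ≠ 0 := by linarith
    simp only [hsum, div_pow, integral_div]
    rw [(memLp_subtreeSum hp hL).2, h0, ih, pow_succ (mean p)⁻¹]
    generalize ∫ ω, (martingaleW p ω i - martingaleW p ω j) ^ 2 ∂(galtonWatson p) = y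
    rw [zero_pow two_ne_zero, mul_zero, add_zero]
    field_simp

lemma eLpNorm_two_eq_ofReal_sqrt {α : Type*} {mα : MeasurableSpace α} {μ : Measure α} {f : α → ℝ}
    (hf : MemLp f 2 μ) : eLpNorm f 2 μ = ENNReal.ofReal (√(∫ x, f x ^ 2 ∂μ)) := by
  rw [hf.eLpNorm_eq_integral_rpow_norm two_ne_zero (by simp), Real.sqrt_eq_rpow]
  simp

/-- A summable `L²` Cauchy rate gives almost sure and `L²` convergence at once, with no filtration
involved. -/
lemma eLpNorm_martingaleW_sub_lt {p : PMF ℕ} (hm : 1 < mean p)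
    (hp : Integrable (fun k : ℕ => (k : ℝ) ^ 2) p.toMeasure) :
    ∃ B : ℕ → ℝ≥0∞, ∑' i, B i ≠ ∞ ∧ ∀ N n m : ℕ, N ≤ n → N ≤ m →
    eLpNorm ((fun ω => martingaleW p ω n) - fun ω => martingaleW p ω m) 2 (galtonWatson p)
      < B N := by
  obtain ⟨K, hK, hKn⟩ := integral_sq_martingaleW_le hm hp
  have hm0 : (0 : ℝ) < mean p := by linarith
  -- `2 √K` comes from `(x - y)² ≤ 2 x² + 2 y²`; the `+ 1` makes the bound strict.
  refine ⟨fun N => ENNReal.ofReal ((2 * √K + 1) * √((mean p)⁻¹) ^ N), ?_, ?_⟩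
  · refine (Summable.tsum_ofReal_lt_top ?_).ne
    refine (summable_geometric_of_lt_one (Real.sqrt_nonneg _) ?_).mul_left _
    rw [Real.sqrt_lt' one_pos, one_pow]
    exact inv_lt_one_of_one_lt₀ hm
  · intro N n m hn hm'
    obtain ⟨i, rfl⟩ := Nat.exists_eq_add_of_le hn
    obtain ⟨j, rfl⟩ := Nat.exists_eq_add_of_le hm'
    rw [eLpNorm_two_eq_ofReal_sqrt ((memLp_martingaleW hp _).sub (memLp_martingaleW hp _))]
    simp only [Pi.sub_apply]
    rw [integral_sq_martingaleW_sub hm hp]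
    have h1 : ∫ ω, (martingaleW p ω i - martingaleW p ω j) ^ 2 ∂(galtonWatson p) ≤ 4 * K := by
      have hi := (memLp_martingaleW hp i).integrable_sq
      have hj := (memLp_martingaleW hp j).integrable_sq
      calc _ ≤ ∫ ω, (2 * martingaleW p ω i ^ 2 + 2 * martingaleW p ω j ^ 2) ∂(galtonWatson p) := by
            refine integral_mono_of_nonneg (Eventually.of_forall fun _ => sq_nonneg _)
              ((hi.const_mul 2).add (hj.const_mul 2)) (Eventually.of_forall fun ω => ?_)
            simp only
            nlinarith [sq_nonneg (martingaleW p ω i + martingaleW p ω j)]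
        _ ≤ _ := by
            rw [integral_add (hi.const_mul 2) (hj.const_mul 2), integral_const_mul,
              integral_const_mul]
            linarith [hKn i, hKn j]
    have h2 : √((mean p)⁻¹ ^ N * ∫ ω, (martingaleW p ω i - martingaleW p ω j) ^ 2
        ∂(galtonWatson p)) ≤ 2 * √K * √((mean p)⁻¹) ^ N := by
      rw [Real.sqrt_le_left (by positivity), mul_pow, ← pow_mul, mul_comm N 2, pow_mul,
        Real.sq_sqrt (by positivity), mul_pow, Real.sq_sqrt hK.le, mul_comm]
      have : (0 : ℝ) ≤ (mean p)⁻¹ ^ N := by positivity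
      nlinarith
    have h3 : 0 < √((mean p)⁻¹) ^ N := by positivity
    rw [ENNReal.ofReal_lt_ofReal_iff (by positivity)]
    nlinarith

theorem ae_tendsto_martingaleW {p : PMF ℕ} (hm : 1 < mean p)
    (hp : Integrable (fun k : ℕ => (k : ℝ) ^ 2) p.toMeasure) : ∀ᵐ ω ∂(galtonWatson p),
    Tendsto (fun n => martingaleW p ω n) atTop (𝓝 (limitW p ω)) := by
  obtain ⟨B, hB, hcau⟩ := eLpNorm_martingaleW_sub_lt hm hp
  filter_upwards [Lp.ae_tendsto_of_cauchy_eLpNorm (fun n => (memLp_martingaleW hp n).1)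
    one_le_two hB hcau] with ω hω
  exact tendsto_nhds_limUnder hω

lemma tendsto_eLpNorm_martingaleW {p : PMF ℕ} (hm : 1 < mean p)
    (hp : Integrable (fun k : ℕ => (k : ℝ) ^ 2) p.toMeasure) : Tendsto
    (fun n => eLpNorm ((fun ω => martingaleW p ω n) - limitW p) 2 (galtonWatson p))
    atTop (𝓝 0) := by
  obtain ⟨B, hB, hcau⟩ := eLpNorm_martingaleW_sub_lt hm hp
  exact Lp.cauchy_tendsto_of_tendsto (fun n => (memLp_martingaleW hp n).1) _ hB hcau
    (ae_tendsto_martingaleW hm hp)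

theorem memLp_limitW {p : PMF ℕ} (hm : 1 < mean p)
    (hp : Integrable (fun k : ℕ => (k : ℝ) ^ 2) p.toMeasure) :
    MemLp (limitW p) 2 (galtonWatson p) :=
  Lp.memLp_of_cauchy_tendsto one_le_two (memLp_martingaleW hp) _
    (aestronglyMeasurable_of_tendsto_ae atTop (fun n => (memLp_martingaleW hp n).1)
      (ae_tendsto_martingaleW hm hp)) (tendsto_eLpNorm_martingaleW hm hp)

theorem integral_limitW {p : PMF ℕ} (hm : 1 < mean p)
    (hp : Integrable (fun k : ℕ => (k : ℝ) ^ 2) p.toMeasure) :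
    ∫ ω, limitW p ω ∂(galtonWatson p) = 1 := by
  have hW := memLp_limitW hm hp
  have h1 : Tendsto (fun n => eLpNorm ((fun ω => martingaleW p ω n) - limitW p) 1
      (galtonWatson p)) atTop (𝓝 0) := by
    refine tendsto_of_tendsto_of_tendsto_of_le_of_le tendsto_const_nhds
      (tendsto_eLpNorm_martingaleW hm hp) (fun _ => zero_le) fun n => ?_
    exact eLpNorm_le_eLpNorm_of_exponent_le one_le_two ((memLp_martingaleW hp n).1.sub hW.1)
  have h2 := tendsto_integral_of_L1' _ hW.1
    (Eventually.of_forall fun n => (memLp_martingaleW hp n).integrable one_le_two) h1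
  simp only [integral_martingaleW hm hp] at h2
  exact (tendsto_nhds_unique h2 tendsto_const_nhds)

theorem limitW_eq_subtreeSum {p : PMF ℕ} (hm : 1 < mean p)
    (hp : Integrable (fun k : ℕ => (k : ℝ) ^ 2) p.toMeasure) :
    limitW p =ᵐ[galtonWatson p] fun ω => subtreeSum (limitW p) ω / mean p := by
  have hae := ae_tendsto_martingaleW hm hp
  have hsub : ∀ᵐ ω ∂(galtonWatson p), ∀ i, Tendsto (fun n => martingaleW p (subtree ω i) n) atTop
      (𝓝 (limitW p (subtree ω i))) :=
    ae_all_iff.2 fun i => (measurePreserving_subtree p i).quasiMeasurePreserving.ae hae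
  filter_upwards [hae, hsub] with ω h1 h2
  refine tendsto_nhds_unique ((tendsto_add_atTop_iff_nat 1).2 h1) ?_
  simp only [martingaleW_succ]
  exact (tendsto_finsetSum _ fun i _ => h2 i).div_const _

/-- The fixed point equation turns the second moment formula into a linear equation for `E W²`. -/
theorem integral_sq_limitW {p : PMF ℕ} (hm : 1 < mean p)
    (hp : Integrable (fun k : ℕ => (k : ℝ) ^ 2) p.toMeasure) :
    ∫ ω, limitW p ω ^ 2 ∂(galtonWatson p) =
    (secondMoment p - mean p) / (mean p * (mean p - 1)) := by
  have hW := memLp_limitW hm hp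
  have h1 : (fun ω => limitW p ω ^ 2) =ᵐ[galtonWatson p]
      fun ω => (subtreeSum (limitW p) ω / mean p) ^ 2 :=
    (limitW_eq_subtreeSum hm hp).fun_comp (· ^ 2)
  have h2 := integral_congr_ae h1
  simp only [div_pow, integral_div] at h2
  rw [(memLp_subtreeSum hp hW).2, integral_limitW hm hp] at h2
  have hm0 : mean p ≠ 0 := by linarith
  have hm1 : mean p - 1 ≠ 0 := by linarith
  rw [eq_div_iff (pow_ne_zero 2 hm0)] at h2
  rw [eq_div_iff (mul_ne_zero hm0 hm1)]
  linarith

theorem one_le_integral_sq_limitW {p : PMF ℕ} (hm : 1 < mean p)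
    (hp : Integrable (fun k : ℕ => (k : ℝ) ^ 2) p.toMeasure) :
    1 ≤ ∫ ω, limitW p ω ^ 2 ∂(galtonWatson p) := by
  have hW := memLp_limitW hm hp
  have h := variance_eq_sub hW
  have h0 := variance_nonneg (limitW p) (galtonWatson p)
  rw [integral_limitW hm hp] at h
  simp only [Pi.pow_apply] at h
  linarith

/-! ### The escape probability of the root -/

lemma conductance_append_singleton (ω : Tree) (lam : ℝ) (n : ℕ) (v : Vertex) (i : ℕ) :
    conductance ω lam n (v ++ [i]) = conductance (subtree ω i) lam n v := by
  induction n generalizing v with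
  | zero => rfl
  | succ n ih =>
    have h (j : ℕ) : conductance ω lam n (j :: (v ++ [i])) =
        conductance (subtree ω i) lam n (j :: v) := ih (j :: v)
    simp only [conductance, h]
    rfl

lemma conductance_root_succ (ω : Tree) (lam : ℝ) (n : ℕ) :
    conductance ω lam (n + 1) [] = subtreeSum (fun ω => conductance ω lam n []) ω /
      (lam + subtreeSum (fun ω => conductance ω lam n []) ω) := by
  have h (i : ℕ) : conductance ω lam n [i] = conductance (subtree ω i) lam n [] :=
    conductance_append_singleton ω lam n [] i
  simp only [conductance, subtreeSum, h]

lemma measurable_conductance_root (p : PMF ℕ) (lam : ℝ) (n : ℕ) :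
    Measurable fun ω => conductance ω lam n [] := by
  induction n with
  | zero => exact measurable_const
  | succ n ih =>
    have h := subtreeSum_of_measurable (p := p) ih
    simp only [conductance_root_succ]
    exact h.div (h.const_add lam)

lemma bias_pos {p : PMF ℕ} (hm : 1 < mean p) (α : ℝ) : 0 < bias p α :=
  mul_pos (by linarith) (Real.exp_pos _)

lemma ae_one_le_offspring {p : PMF ℕ} (hp0 : p 0 = 0) :
    ∀ᵐ ω ∂(galtonWatson p), ∀ v, 1 ≤ ω v := by
  rw [ae_all_iff]
  intro v
  have h : ∀ᵐ k ∂p.toMeasure, 1 ≤ k := by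
    rw [ae_iff]
    have : {a : ℕ | ¬1 ≤ a} = {0} := by ext; simp
    rw [this, p.toMeasure_apply_singleton 0 (measurableSet_singleton 0), hp0]
  exact (measurePreserving_eval_infinitePi
    (fun _ : Vertex => p.toMeasure) v).quasiMeasurePreserving.ae h

lemma tendsto_conductance_root (ω : Tree) {lam : ℝ} (hl : 0 < lam) :
    ∃ l, Tendsto (fun n => conductance ω lam n []) atTop (𝓝 l) :=
  ⟨_, tendsto_atTop_ciInf (antitone_nat_of_succ_le fun n => conductance_succ_le ω hl n [])
    ⟨0, by rintro _ ⟨n, rfl⟩; exact conductance_nonneg ω hl n []⟩⟩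

lemma tendsto_escapeBeforeRoot {p : PMF ℕ} (hm : 1 < mean p) (α : ℝ) {ω : Tree}
    (hω : ∀ v, 1 ≤ ω v) :
    Tendsto (fun n => escapeBeforeRoot ω (bias p α) n) atTop (𝓝 (escapeRoot p α ω)) := by
  obtain ⟨l, hlim⟩ := tendsto_conductance_root ω (bias_pos hm α)
  refine tendsto_nhds_limUnder ⟨l, (tendsto_add_atTop_iff_nat 1).1 ?_⟩
  simp only [escapeBeforeRoot_eq_conductance ω hω (bias_pos hm α)]
  exact (tendsto_add_atTop_iff_nat 1).2 hlim

lemma tendsto_conductance_escapeRoot {p : PMF ℕ} (hm : 1 < mean p) (α : ℝ) {ω : Tree}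
    (hω : ∀ v, 1 ≤ ω v) :
    Tendsto (fun n => conductance ω (bias p α) n []) atTop (𝓝 (escapeRoot p α ω)) := by
  have h := (tendsto_add_atTop_iff_nat 1).2 (tendsto_escapeBeforeRoot hm α hω)
  simp only [escapeBeforeRoot_eq_conductance ω hω (bias_pos hm α)] at h
  exact (tendsto_add_atTop_iff_nat 1).1 h

lemma escapeRoot_mem_Icc {p : PMF ℕ} (hm : 1 < mean p) (α : ℝ) {ω : Tree}
    (hω : ∀ v, 1 ≤ ω v) : 0 ≤ escapeRoot p α ω ∧ escapeRoot p α ω ≤ 1 := by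
  have h := tendsto_conductance_escapeRoot hm α hω
  exact ⟨ge_of_tendsto' h fun n => conductance_nonneg ω (bias_pos hm α) n [],
    le_of_tendsto' h fun n => conductance_le_one ω (bias_pos hm α) n []⟩

lemma aestronglyMeasurable_escapeRoot {p : PMF ℕ} (hp0 : p 0 = 0) (hm : 1 < mean p) (α : ℝ) :
    AEStronglyMeasurable (escapeRoot p α) (galtonWatson p) :=
  aestronglyMeasurable_of_tendsto_ae atTop
    (fun n => (measurable_conductance_root p (bias p α) n).aestronglyMeasurable)
    ((ae_one_le_offspring hp0).mono fun _ hω => tendsto_conductance_escapeRoot hm α hω)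

lemma memLp_escapeRoot {p : PMF ℕ} (hp0 : p 0 = 0) (hm : 1 < mean p) (α : ℝ) :
    MemLp (escapeRoot p α) 2 (galtonWatson p) := by
  refine MemLp.of_bound (aestronglyMeasurable_escapeRoot hp0 hm α) 1 ?_
  filter_upwards [ae_one_le_offspring hp0] with ω hω
  have := escapeRoot_mem_Icc hm α hω
  rw [Real.norm_of_nonneg this.1]
  exact this.2

lemma one_le_subtree {ω : Tree} (hω : ∀ v, 1 ≤ ω v) (i : ℕ) : ∀ v, 1 ≤ subtree ω i v :=
  fun _ => hω _

lemma subtreeSum_escapeRoot_nonneg {p : PMF ℕ} (hm : 1 < mean p) (α : ℝ) {ω : Tree}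
    (hω : ∀ v, 1 ≤ ω v) : 0 ≤ subtreeSum (escapeRoot p α) ω :=
  Finset.sum_nonneg fun i _ => (escapeRoot_mem_Icc hm α (one_le_subtree hω i)).1

/-- The recursion for the escape probability. -/
lemma escapeRoot_mul_eq {p : PMF ℕ} (hm : 1 < mean p) (α : ℝ) {ω : Tree}
    (hω : ∀ v, 1 ≤ ω v) :
    escapeRoot p α ω * (bias p α + subtreeSum (escapeRoot p α) ω) =
      subtreeSum (escapeRoot p α) ω := by
  have hS : Tendsto (fun n => subtreeSum (fun ω => conductance ω (bias p α) n []) ω) atTop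
      (𝓝 (subtreeSum (escapeRoot p α) ω)) :=
    tendsto_finsetSum _ fun i _ => tendsto_conductance_escapeRoot hm α (one_le_subtree hω i)
  have hpos : bias p α + subtreeSum (escapeRoot p α) ω ≠ 0 :=
    (add_pos_of_pos_of_nonneg (bias_pos hm α) (subtreeSum_escapeRoot_nonneg hm α hω)).ne'
  have h1 := (tendsto_add_atTop_iff_nat 1).2 (tendsto_conductance_escapeRoot hm α hω)
  simp only [conductance_root_succ] at h1
  have h2 := tendsto_nhds_unique h1 (hS.div (hS.const_add _) hpos)
  rw [h2, div_mul_cancel₀ _ hpos]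

/-! ### A lower bound on the escape probability -/

/-- The energy of the flow of strength `W(o, n)` that is proportional to the number of
descendants in generation `n`. -/
noncomputable def flowEnergy (p : PMF ℕ) (lam : ℝ) : ℕ → Tree → ℝ
  | 0, _ => 1
  | n + 1, ω => martingaleW p ω (n + 1) ^ 2 +
      lam / mean p ^ 2 * subtreeSum (flowEnergy p lam n) ω

lemma flowEnergy_nonneg (p : PMF ℕ) {lam : ℝ} (hl : 0 < lam) (n : ℕ) (ω : Tree) :
    0 ≤ flowEnergy p lam n ω := by
  induction n generalizing ω with
  | zero => simp [flowEnergy]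
  | succ n ih =>
    have : 0 ≤ subtreeSum (flowEnergy p lam n) ω := Finset.sum_nonneg fun i _ => ih _
    rw [flowEnergy]
    positivity

/-- Thomson's principle for the flow of `flowEnergy`. -/
lemma sq_martingaleW_le {p : PMF ℕ} (hm : 1 < mean p) {lam : ℝ} (hl : 0 < lam) (n : ℕ)
    (ω : Tree) :
    martingaleW p ω n ^ 2 ≤ conductance ω lam n [] * flowEnergy p lam n ω := by
  induction n generalizing ω with
  | zero => simp [flowEnergy, conductance, martingaleW_zero]
  | succ n ih =>
    have hm0 : (0 : ℝ) < mean p := by linarith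
    have hc (ω : Tree) := conductance_nonneg ω hl n []
    have he := flowEnergy_nonneg p hl n
    set S := subtreeSum (fun ω => conductance ω lam n []) ω with hS
    set E := subtreeSum (flowEnergy p lam n) ω with hE
    have hS0 : 0 ≤ S := Finset.sum_nonneg fun i _ => hc _
    -- Cauchy–Schwarz over the children, with the induction hypothesis applied to each subtree.
    have hCS : (subtreeSum (fun ω => martingaleW p ω n) ω) ^ 2 ≤ S * E :=
      Finset.sum_sq_le_sum_mul_sum_of_sq_le_mul _ (fun i _ => hc _) (fun i _ => he _)
        fun i _ => ih _
    rw [conductance_root_succ, ← hS, flowEnergy, ← hE, div_mul_eq_mul_div,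
      le_div_iff₀ (by positivity)]
    have h1 : martingaleW p ω (n + 1) ^ 2 * mean p ^ 2 ≤ S * E := by
      rw [martingaleW_succ, div_pow, div_mul_cancel₀ _ (by positivity)]
      exact hCS
    have h2 : martingaleW p ω (n + 1) ^ 2 * lam ≤ S * (lam / mean p ^ 2 * E) := by
      have e : S * (lam / mean p ^ 2 * E) = (S * E) * lam / mean p ^ 2 := by ring
      rw [e, le_div_iff₀ (by positivity)]
      nlinarith
    linarith

/-- As `lam < mean p`, the mean flow energies stay bounded, and Thomson's principle with `E W(o, n)
= 1` bounds the mean conductances below uniformly in `n`. -/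
theorem integral_escapeRoot_pos {p : PMF ℕ} (hp0 : p 0 = 0) (hm : 1 < mean p)
    (hp : Integrable (fun k : ℕ => (k : ℝ) ^ 2) p.toMeasure) {α : ℝ} (hα : 0 < α) :
    0 < ∫ ω, escapeRoot p α ω ∂(galtonWatson p) := by
  have hm0 : (0 : ℝ) < mean p := by linarith
  set lam := bias p α with hlam
  have hl : 0 < lam := bias_pos hm α
  have hlm : lam < mean p := by
    rw [hlam, bias]
    exact mul_lt_of_lt_one_right hm0 (by simpa using hα)
  obtain ⟨K, hK, hKn⟩ := integral_sq_martingaleW_le hm hp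
  have hr : 0 < 1 - lam / mean p := by
    rw [sub_pos, div_lt_one hm0]
    exact hlm
  -- The fixed point of the bound `e ↦ K + (lam / m) e` for the mean energies.
  set K' := K / (1 - lam / mean p) with hK'
  have hK'0 : 0 < K' := div_pos hK hr
  have hKK' : K + lam / mean p * K' = K' := by
    have h : K' * (1 - lam / mean p) = K := div_mul_cancel₀ _ hr.ne'
    linear_combination -h
  have hK1 : 1 ≤ K' := by
    have h0 := hKn 0
    simp only [martingaleW_zero, one_pow, integral_const, probReal_univ, smul_eq_mul,
      mul_one] at h0
    have : 0 ≤ lam / mean p * K' := by positivity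
    linarith
  have hE (n : ℕ) : Integrable (flowEnergy p lam n) (galtonWatson p) ∧
      ∫ ω, flowEnergy p lam n ω ∂(galtonWatson p) ≤ K' := by
    induction n with
    | zero =>
      constructor
      · exact integrable_const (1 : ℝ)
      · simpa [flowEnergy] using hK1
    | succ n ih =>
      obtain ⟨h1, h2⟩ := integrable_subtreeSum hp ih.1
      have hW := (memLp_martingaleW hp (n + 1)).integrable_sq
      refine ⟨hW.add (h1.const_mul _), ?_⟩
      simp only [flowEnergy]
      rw [integral_add hW (h1.const_mul _), integral_const_mul, h2]
      calc _ ≤ K + lam / mean p ^ 2 * (mean p * K') := by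
            gcongr
            · exact hKn _
            · exact ih.2
        _ = K + lam / mean p * K' := by field_simp
        _ = K' := hKK'
  have hC (n : ℕ) : Integrable (fun ω => conductance ω lam n []) (galtonWatson p) := by
    refine Integrable.of_bound
      (measurable_conductance_root p lam n).aestronglyMeasurable 1
      (Eventually.of_forall fun ω => ?_)
    rw [Real.norm_of_nonneg (conductance_nonneg ω hl n [])]
    exact conductance_le_one ω hl n []
  have hlow (n : ℕ) : K'⁻¹ ≤ ∫ ω, conductance ω lam n [] ∂(galtonWatson p) := by
    -- The arithmetic-geometric mean inequality linearises Thomson's bound; with weight `K'` the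
    -- energy term contributes at most `1/2`.
    have h1 : ∫ ω, martingaleW p ω n ∂(galtonWatson p) ≤
        ∫ ω, (K' / 2 * conductance ω lam n [] + (2 * K')⁻¹ * flowEnergy p lam n ω)
          ∂(galtonWatson p) := by
      refine integral_mono ((memLp_martingaleW hp n).integrable one_le_two)
        (((hC n).const_mul _).add ((hE n).1.const_mul _)) fun ω => ?_
      have h2 := sq_martingaleW_le hm hl n ω
      have h3 := conductance_nonneg ω hl n []
      have h4 := flowEnergy_nonneg p hl n ω
      set x := K' / 2 * conductance ω lam n [] with hx
      set y := (2 * K')⁻¹ * flowEnergy p lam n ω with hy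
      have hxy : conductance ω lam n [] * flowEnergy p lam n ω = 4 * (x * y) := by
        rw [hx, hy]
        field_simp
        ring
      have hx0 : 0 ≤ x := by positivity
      have hy0 : 0 ≤ y := by positivity
      refine abs_le_of_sq_le_sq' ?_ (add_nonneg hx0 hy0) |>.2
      nlinarith [sq_nonneg (x - y)]
    rw [integral_martingaleW hm hp, integral_add ((hC n).const_mul _) ((hE n).1.const_mul _),
      integral_const_mul, integral_const_mul] at h1
    have h5 : (2 * K')⁻¹ * ∫ ω, flowEnergy p lam n ω ∂(galtonWatson p) ≤ (2 * K')⁻¹ * K' := by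
      gcongr
      exact (hE n).2
    have h6 : (2 * K')⁻¹ * K' = 1 / 2 := by field_simp
    rw [inv_le_iff_one_le_mul₀ hK'0]
    linarith
  have hlim : Tendsto (fun n => ∫ ω, conductance ω lam n [] ∂(galtonWatson p)) atTop
      (𝓝 (∫ ω, escapeRoot p α ω ∂(galtonWatson p))) := by
    refine tendsto_integral_of_dominated_convergence (fun _ => 1)
      (fun n => (hC n).1) (integrable_const _) (fun n => Eventually.of_forall fun ω => ?_) ?_
    · rw [Real.norm_of_nonneg (conductance_nonneg ω hl n [])]
      exact conductance_le_one ω hl n []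
    · filter_upwards [ae_one_le_offspring hp0] with ω hω
      exact tendsto_conductance_escapeRoot hm α hω
  exact (inv_pos.2 hK'0).trans_le (ge_of_tendsto' hlim hlow)

/-! ### Convergence of the rescaled escape probability -/

lemma abs_integral_mul_le_sqrt {α : Type*} {mα : MeasurableSpace α} {μ : Measure α}
    {f g : α → ℝ} (hf : MemLp f 2 μ) (hg : MemLp g 2 μ) :
    |∫ x, f x * g x ∂μ| ≤ √(∫ x, f x ^ 2 ∂μ) * √(∫ x, g x ^ 2 ∂μ) := by
  have h := integral_mul_norm_le_Lp_mul_Lq (μ := μ) (f := f) (g := g)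
    Real.HolderConjugate.two_two (by simpa using hf) (by simpa using hg)
  have h1 : |∫ x, f x * g x ∂μ| ≤ ∫ x, ‖f x‖ * ‖g x‖ ∂μ := by
    simpa only [Real.norm_eq_abs, abs_mul] using
      abs_integral_le_integral_abs (μ := μ) (f := fun x => f x * g x)
  refine h1.trans (h.trans_eq ?_)
  simp [Real.sqrt_eq_rpow]

/-- Truncation: `f g ≤ (f - min f K) + K g` when `0 ≤ g ≤ 1`. It is applied with `f = W²`, so no
fourth moment of `W` is needed. -/
lemma tendsto_integral_mul_of_tendsto_integral {ι Ω : Type*} {mΩ : MeasurableSpace Ω}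
    {μ : Measure Ω} {l : Filter ι} {f : Ω → ℝ} {g : ι → Ω → ℝ} (hf : Integrable f μ)
    (hf0 : ∀ x, 0 ≤ f x) (hg : ∀ i, Integrable (g i) μ) (hg0 : ∀ i, ∀ᵐ x ∂μ, 0 ≤ g i x)
    (hg1 : ∀ i, ∀ᵐ x ∂μ, g i x ≤ 1) (hlim : Tendsto (fun i => ∫ x, g i x ∂μ) l (𝓝 0)) :
    Tendsto (fun i => ∫ x, f x * g i x ∂μ) l (𝓝 0) := by
  have htail : Tendsto (fun K : ℕ => ∫ x, (f x - min (f x) K) ∂μ) atTop (𝓝 (∫ _, (0 : ℝ) ∂μ)) := by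
    refine tendsto_integral_of_dominated_convergence f
      (fun K => hf.1.sub (hf.1.inf aestronglyMeasurable_const)) hf
      (fun K => Eventually.of_forall fun x => ?_) (Eventually.of_forall fun x => ?_)
    · rw [Real.norm_of_nonneg (sub_nonneg.2 (min_le_left _ _))]
      exact sub_le_self _ (le_min (hf0 x) (Nat.cast_nonneg K))
    · obtain ⟨N, hN⟩ := exists_nat_ge (f x)
      refine tendsto_const_nhds.congr' ?_
      filter_upwards [eventually_ge_atTop N] with K hK
      rw [min_eq_left (hN.trans (by exact_mod_cast hK)), sub_self]
  rw [integral_zero] at htail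
  rw [Metric.tendsto_nhds]
  intro ε hε
  obtain ⟨K, hK⟩ := (htail.eventually (gt_mem_nhds (half_pos hε))).exists
  have h2 : Tendsto (fun i => (K : ℝ) * ∫ x, g i x ∂μ) l (𝓝 0) := by
    simpa using hlim.const_mul (K : ℝ)
  filter_upwards [h2.eventually (gt_mem_nhds (half_pos hε))] with i hi
  have hnonneg : 0 ≤ ∫ x, f x * g i x ∂μ :=
    integral_nonneg_of_ae ((hg0 i).mono fun x hx => mul_nonneg (hf0 x) hx)
  have htailint : Integrable (fun x => f x - min (f x) K) μ := by
    refine hf.mono' (hf.1.sub (hf.1.inf aestronglyMeasurable_const))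
      (Eventually.of_forall fun x => ?_)
    rw [Real.norm_of_nonneg (sub_nonneg.2 (min_le_left _ _))]
    exact sub_le_self _ (le_min (hf0 x) (Nat.cast_nonneg K))
  have hle : ∫ x, f x * g i x ∂μ ≤ ∫ x, ((f x - min (f x) K) + K * g i x) ∂μ := by
    refine integral_mono_of_nonneg ((hg0 i).mono fun x hx => mul_nonneg (hf0 x) hx)
      (htailint.add ((hg i).const_mul _)) ?_
    filter_upwards [hg0 i, hg1 i] with x h0 h1
    have h3 : 0 ≤ f x - min (f x) K := sub_nonneg.2 (min_le_left _ _)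
    have h4 : min (f x) K ≤ K := min_le_right _ _
    nlinarith [mul_nonneg h3 (sub_nonneg.2 h1), mul_nonneg (sub_nonneg.2 h4) h0]
  rw [integral_add htailint ((hg i).const_mul _), integral_const_mul] at hle
  rw [Real.dist_eq, sub_zero, abs_of_nonneg hnonneg]
  linarith

lemma mean_eq_exp_mul_bias (p : PMF ℕ) (α : ℝ) : mean p = Real.exp α * bias p α := by
  rw [bias, mul_left_comm, ← Real.exp_add]
  simp

section

variable {p : PMF ℕ}

/-- The mean of the escape probability of the root. -/
noncomputable def meanEscape (p : PMF ℕ) (α : ℝ) : ℝ := ∫ ω, escapeRoot p α ω ∂(galtonWatson p)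

/-- The `L²` distance, squared, between the normalized escape probability and `W`. -/
noncomputable def sqDist (p : PMF ℕ) (α : ℝ) : ℝ :=
  ∫ ω, (escapeRoot p α ω / meanEscape p α - limitW p ω) ^ 2 ∂(galtonWatson p)

lemma memLp_subtreeSum_escapeRoot (hp0 : p 0 = 0) (hm : 1 < mean p)
    (hp : Integrable (fun k : ℕ => (k : ℝ) ^ 2) p.toMeasure) (α : ℝ) :
    MemLp (subtreeSum (escapeRoot p α)) 2 (galtonWatson p) :=
  (memLp_subtreeSum hp (memLp_escapeRoot hp0 hm α)).1

/-- The recursion reads `β S = S - λ β`. In the mean the linear terms nearly cancel, so the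
quadratic term determines the size of `E β`. -/
lemma sub_bias_mul_meanEscape (hp0 : p 0 = 0) (hm : 1 < mean p)
    (hp : Integrable (fun k : ℕ => (k : ℝ) ^ 2) p.toMeasure) (α : ℝ) :
    (mean p - bias p α) * meanEscape p α =
      ∫ ω, escapeRoot p α ω * subtreeSum (escapeRoot p α) ω ∂(galtonWatson p) := by
  have hβ := (memLp_escapeRoot hp0 hm α)
  have hβ1 := hβ.integrable one_le_two
  obtain ⟨hS1, hS2⟩ := integrable_subtreeSum hp hβ1
  have h : (fun ω => escapeRoot p α ω * subtreeSum (escapeRoot p α) ω) =ᵐ[galtonWatson p]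
      fun ω => subtreeSum (escapeRoot p α) ω - bias p α * escapeRoot p α ω := by
    filter_upwards [ae_one_le_offspring hp0] with ω hω
    linear_combination escapeRoot_mul_eq hm α hω
  rw [integral_congr_ae h, integral_sub hS1 (hβ1.const_mul _), hS2, integral_const_mul,
    meanEscape]
  ring

/-- From `λ β = (1 - β) S ≤ S` follows `λ β² ≤ β S`, whose mean is at most `m - λ = λ (e^α - 1)`
since `E β ≤ 1`. This a priori bound gives `β → 0` in `L²`. -/
lemma bias_mul_integral_sq_le (hp0 : p 0 = 0) (hm : 1 < mean p)
    (hp : Integrable (fun k : ℕ => (k : ℝ) ^ 2) p.toMeasure) {α : ℝ} (hα : 0 < α) :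
    ∫ ω, escapeRoot p α ω ^ 2 ∂(galtonWatson p) ≤ Real.exp α - 1 := by
  have hl := bias_pos hm α
  have hβ := (memLp_escapeRoot hp0 hm α)
  have hS := memLp_subtreeSum_escapeRoot hp0 hm hp α
  have hle : ∫ ω, bias p α * escapeRoot p α ω ^ 2 ∂(galtonWatson p) ≤
      ∫ ω, escapeRoot p α ω * subtreeSum (escapeRoot p α) ω ∂(galtonWatson p) := by
    refine integral_mono_ae (hβ.integrable_sq.const_mul _) (hβ.integrable_mul hS) ?_
    filter_upwards [ae_one_le_offspring hp0] with ω hω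
    have h1 := escapeRoot_mul_eq hm α hω
    have h2 := escapeRoot_mem_Icc hm α hω
    have h3 := subtreeSum_escapeRoot_nonneg hm α hω
    nlinarith [mul_nonneg h2.1 (mul_nonneg h2.1 h3)]
  rw [integral_const_mul, ← sub_bias_mul_meanEscape hp0 hm hp] at hle
  have ha : meanEscape p α ≤ 1 := by
    have : ∫ ω, escapeRoot p α ω ∂(galtonWatson p) ≤ ∫ _, (1 : ℝ) ∂(galtonWatson p) := by
      refine integral_mono_ae (hβ.integrable one_le_two) (integrable_const _) ?_
      filter_upwards [ae_one_le_offspring hp0] with ω hω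
      exact (escapeRoot_mem_Icc hm α hω).2
    simpa [meanEscape] using this
  have he : 0 ≤ Real.exp α - 1 := by
    have := Real.one_le_exp hα.le
    linarith
  have hmb : mean p - bias p α = bias p α * (Real.exp α - 1) := by
    rw [mean_eq_exp_mul_bias p α]; ring
  rw [hmb] at hle
  have h5 : bias p α * ∫ ω, escapeRoot p α ω ^ 2 ∂(galtonWatson p) ≤
      bias p α * (Real.exp α - 1) :=
    hle.trans (mul_le_of_le_one_right (mul_nonneg hl.le he) ha)
  exact le_of_mul_le_mul_left h5 hl

lemma tendsto_integral_sq_limitW_mul (hp0 : p 0 = 0) (hm : 1 < mean p)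
    (hp : Integrable (fun k : ℕ => (k : ℝ) ^ 2) p.toMeasure) :
    Tendsto (fun α => ∫ ω, limitW p ω ^ 2 * escapeRoot p α ω ^ 2 ∂(galtonWatson p))
      (𝓝[>] 0) (𝓝 0) := by
  refine tendsto_integral_mul_of_tendsto_integral (memLp_limitW hm hp).integrable_sq
    (fun ω => sq_nonneg _) (fun α => (memLp_escapeRoot hp0 hm α).integrable_sq)
    (fun α => Eventually.of_forall fun ω => sq_nonneg _) (fun α => ?_) ?_
  · filter_upwards [ae_one_le_offspring hp0] with ω hω
    have h := escapeRoot_mem_Icc hm α hω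
    exact pow_le_one₀ h.1 h.2
  · have hexp : Tendsto (fun α : ℝ => Real.exp α - 1) (𝓝[>] 0) (𝓝 0) := by
      have : Tendsto (fun α : ℝ => Real.exp α - 1) (𝓝 0) (𝓝 (Real.exp 0 - 1)) :=
        (Real.continuous_exp.sub continuous_const).tendsto 0
      simpa using this.mono_left nhdsWithin_le_nhds
    refine tendsto_of_tendsto_of_tendsto_of_le_of_le' tendsto_const_nhds hexp
      (Eventually.of_forall fun α => integral_nonneg fun ω => sq_nonneg _) ?_
    filter_upwards [self_mem_nhdsWithin] with α hα
    exact bias_mul_integral_sq_le hp0 hm hp hα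

/-! ### Contraction of the normalized escape probability towards `W` -/

/-- The difference between one branching step applied to the normalized escape probability and
to `W`. -/
noncomputable def branchDiff (p : PMF ℕ) (α : ℝ) (ω : Tree) : ℝ :=
  subtreeSum (escapeRoot p α) ω / (mean p * meanEscape p α) - limitW p ω

lemma memLp_normalized (hp0 : p 0 = 0) (hm : 1 < mean p)
    (hp : Integrable (fun k : ℕ => (k : ℝ) ^ 2) p.toMeasure) (α : ℝ) :
    MemLp (fun ω => escapeRoot p α ω / meanEscape p α - limitW p ω) 2 (galtonWatson p) := by
  simp only [div_eq_inv_mul]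
  exact ((memLp_escapeRoot hp0 hm α).const_mul _).sub (memLp_limitW hm hp)

lemma memLp_branchDiff (hp0 : p 0 = 0) (hm : 1 < mean p)
    (hp : Integrable (fun k : ℕ => (k : ℝ) ^ 2) p.toMeasure) (α : ℝ) :
    MemLp (branchDiff p α) 2 (galtonWatson p) := by
  unfold branchDiff
  simp only [div_eq_inv_mul]
  exact ((memLp_subtreeSum_escapeRoot hp0 hm hp α).const_mul _).sub (memLp_limitW hm hp)

/-- As `W` is a fixed point, `branchDiff` is the branching operator applied to `β / a - W`, which is
centred because both terms have mean one. -/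
lemma integral_sq_branchDiff (hp0 : p 0 = 0) (hm : 1 < mean p)
    (hp : Integrable (fun k : ℕ => (k : ℝ) ^ 2) p.toMeasure) {α : ℝ} (hα : 0 < α) :
    ∫ ω, branchDiff p α ω ^ 2 ∂(galtonWatson p) = sqDist p α / mean p := by
  have hm0 : mean p ≠ 0 := by linarith
  have ha : meanEscape p α ≠ 0 := (integral_escapeRoot_pos hp0 hm hp hα).ne'
  have h : (fun ω => branchDiff p α ω ^ 2) =ᵐ[galtonWatson p] fun ω =>
      subtreeSum (fun ω => escapeRoot p α ω / meanEscape p α - limitW p ω) ω ^ 2 / mean p ^ 2 := by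
    filter_upwards [limitW_eq_subtreeSum hm hp] with ω hω
    rw [branchDiff, hω, ← div_pow]
    congr 1
    simp only [subtreeSum, Finset.sum_sub_distrib, ← Finset.sum_div]
    field_simp
  have h0 : ∫ ω, (escapeRoot p α ω / meanEscape p α - limitW p ω) ∂(galtonWatson p) = 0 := by
    rw [integral_sub (((memLp_escapeRoot hp0 hm α).integrable one_le_two).div_const _)
      ((memLp_limitW hm hp).integrable one_le_two), integral_div, integral_limitW hm hp,
      ← meanEscape, div_self ha, sub_self]
  rw [integral_congr_ae h, integral_div, (memLp_subtreeSum hp (memLp_normalized hp0 hm hp α)).2,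
    h0, ← sqDist]
  field_simp
  ring

/-- The contraction estimate behind the convergence. -/
lemma sqDist_le (hp0 : p 0 = 0) (hm : 1 < mean p)
    (hp : Integrable (fun k : ℕ => (k : ℝ) ^ 2) p.toMeasure) {α δ : ℝ} (hα : 0 < α)
    (hδ : 0 < δ) :
    sqDist p α ≤ (1 + δ) * Real.exp α ^ 2 / mean p * sqDist p α + (1 + δ⁻¹) *
      (2 * (Real.exp α - 1) ^ 2 * ∫ ω, limitW p ω ^ 2 ∂(galtonWatson p) +
        2 * Real.exp α ^ 2 * ∫ ω, limitW p ω ^ 2 * escapeRoot p α ω ^ 2 ∂(galtonWatson p)) := by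
  have hm0 : mean p ≠ 0 := by linarith
  have hl := bias_pos hm α
  have ha : 0 < meanEscape p α := integral_escapeRoot_pos hp0 hm hp hα
  have hX := (memLp_branchDiff hp0 hm hp α).integrable_sq
  have hW := (memLp_limitW hm hp).integrable_sq
  have hWβ : Integrable (fun ω => limitW p ω ^ 2 * escapeRoot p α ω ^ 2) (galtonWatson p) := by
    refine hW.mono' (hW.1.mul (memLp_escapeRoot hp0 hm α).integrable_sq.1) ?_
    filter_upwards [ae_one_le_offspring hp0] with ω hω
    have h := escapeRoot_mem_Icc hm α hω
    rw [Real.norm_of_nonneg (by positivity)]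
    exact mul_le_of_le_one_right (sq_nonneg _) (pow_le_one₀ h.1 h.2)
  have hi1 := hX.const_mul ((1 + δ) * Real.exp α ^ 2)
  have hi2 := hW.const_mul ((1 + δ⁻¹) * (2 * (Real.exp α - 1) ^ 2))
  have hi3 := hWβ.const_mul ((1 + δ⁻¹) * (2 * Real.exp α ^ 2))
  have hi23 : Integrable (fun ω => (1 + δ⁻¹) * (2 * (Real.exp α - 1) ^ 2) * limitW p ω ^ 2 +
      (1 + δ⁻¹) * (2 * Real.exp α ^ 2) * (limitW p ω ^ 2 * escapeRoot p α ω ^ 2))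
      (galtonWatson p) := hi2.add hi3
  calc sqDist p α ≤ ∫ ω, ((1 + δ) * Real.exp α ^ 2 * branchDiff p α ω ^ 2 +
        ((1 + δ⁻¹) * (2 * (Real.exp α - 1) ^ 2) * limitW p ω ^ 2 +
        (1 + δ⁻¹) * (2 * Real.exp α ^ 2) * (limitW p ω ^ 2 * escapeRoot p α ω ^ 2)))
        ∂(galtonWatson p) := by
        refine integral_mono_ae (memLp_normalized hp0 hm hp α).integrable_sq
          (hi1.add hi23) ?_
        filter_upwards [ae_one_le_offspring hp0] with ω hω
        have h1 := escapeRoot_mul_eq hm α hω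
        have h2 := escapeRoot_mem_Icc hm α hω
        -- Exact form of the recursion: `β / a = e^α (1 - β) S / (m a)`, by `m = e^α λ`.
        have hid : escapeRoot p α ω / meanEscape p α - limitW p ω =
            Real.exp α * (1 - escapeRoot p α ω) * branchDiff p α ω +
              limitW p ω * (Real.exp α * (1 - escapeRoot p α ω) - 1) := by
          have h3 : escapeRoot p α ω = (1 - escapeRoot p α ω) *
              subtreeSum (escapeRoot p α) ω / bias p α := by
            rw [eq_div_iff hl.ne']
            linear_combination h1
          have h4 : Real.exp α * (1 - escapeRoot p α ω) *
              (subtreeSum (escapeRoot p α) ω / (mean p * meanEscape p α)) =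
              escapeRoot p α ω / meanEscape p α := by
            conv_rhs => rw [h3]
            rw [mean_eq_exp_mul_bias p α]
            have := (Real.exp_pos α).ne'
            field_simp
          rw [branchDiff, mul_sub, h4]
          ring
        rw [hid]
        set x := branchDiff p α ω
        set w := limitW p ω
        set β := escapeRoot p α ω
        set E := Real.exp α with hE
        have hE0 : 0 < E := Real.exp_pos α
        -- Young's inequality with a free weight, since a factor `2` on the main term could destroy
        -- the contraction.
        have hy : ∀ u v : ℝ, (u + v) ^ 2 ≤ (1 + δ) * u ^ 2 + (1 + δ⁻¹) * v ^ 2 := by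
          intro u v
          have e : (1 + δ) * u ^ 2 + (1 + δ⁻¹) * v ^ 2 - (u + v) ^ 2 = δ⁻¹ * (δ * u - v) ^ 2 := by
            field_simp
            ring
          have : 0 ≤ δ⁻¹ * (δ * u - v) ^ 2 := by positivity
          linarith
        refine (hy _ _).trans ?_
        have h5 : (E * (1 - β) * x) ^ 2 ≤ E ^ 2 * x ^ 2 := by
          have : (1 - β) ^ 2 ≤ 1 := pow_le_one₀ (by linarith [h2.2]) (by linarith [h2.1])
          have h6 : (E * (1 - β) * x) ^ 2 = (E ^ 2 * x ^ 2) * (1 - β) ^ 2 := by ring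
          rw [h6]
          exact mul_le_of_le_one_right (by positivity) this
        have h7 : (w * (E * (1 - β) - 1)) ^ 2 ≤
            2 * (E - 1) ^ 2 * w ^ 2 + 2 * E ^ 2 * (w ^ 2 * β ^ 2) := by
          have e : 2 * (E - 1) ^ 2 * w ^ 2 + 2 * E ^ 2 * (w ^ 2 * β ^ 2) -
              (w * (E * (1 - β) - 1)) ^ 2 = (w * (E - 1 + E * β)) ^ 2 := by ring
          linarith [sq_nonneg (w * (E - 1 + E * β))]
        have h8 := mul_le_mul_of_nonneg_left h5 (by positivity : 0 ≤ 1 + δ)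
        have h9 := mul_le_mul_of_nonneg_left h7 (by positivity : 0 ≤ 1 + δ⁻¹)
        linarith
    _ = _ := by
        rw [integral_add hi1 hi23, integral_add hi2 hi3, integral_const_mul,
          integral_const_mul, integral_const_mul, integral_sq_branchDiff hp0 hm hp hα]
        ring

lemma sqDist_nonneg (p : PMF ℕ) (α : ℝ) : 0 ≤ sqDist p α := integral_nonneg fun _ => sq_nonneg _

theorem tendsto_sqDist (hp0 : p 0 = 0) (hm : 1 < mean p)
    (hp : Integrable (fun k : ℕ => (k : ℝ) ^ 2) p.toMeasure) :
    Tendsto (sqDist p) (𝓝[>] 0) (𝓝 0) := by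
  have hm0 : (0 : ℝ) < mean p := by linarith
  -- Then `(1 + δ) / m = (m + 1) / (2 m) < 1`, so for small `α` the main term can be absorbed into
  -- the left side.
  set δ := (mean p - 1) / 2 with hδ
  have hδ0 : 0 < δ := by rw [hδ]; linarith
  have hexp : Tendsto Real.exp (𝓝[>] 0) (𝓝 1) := by
    simpa using (Real.continuous_exp.tendsto 0).mono_left nhdsWithin_le_nhds
  have hq : Tendsto (fun α => (1 + δ) * Real.exp α ^ 2 / mean p) (𝓝[>] 0)
      (𝓝 ((1 + δ) * 1 ^ 2 / mean p)) := ((hexp.pow 2).const_mul _).div_const _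
  have hq1 : (1 + δ) * 1 ^ 2 / mean p < 1 := by
    rw [div_lt_one hm0, hδ]; linarith
  have hV := ((((hexp.sub_const 1).pow 2).const_mul 2).mul_const
    (∫ ω, limitW p ω ^ 2 ∂(galtonWatson p))).add
    (((hexp.pow 2).const_mul 2).mul (tendsto_integral_sq_limitW_mul hp0 hm hp))
  have hbound := (hV.const_mul (1 + δ⁻¹)).div (hq.const_sub 1) (sub_pos.2 hq1).ne'
  have hbound' := hbound.trans_eq (by simp : _ = 𝓝 (0 : ℝ))
  refine tendsto_of_tendsto_of_tendsto_of_le_of_le' tendsto_const_nhds hbound'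
    (Eventually.of_forall fun α => sqDist_nonneg p α) ?_
  filter_upwards [self_mem_nhdsWithin, hq.eventually (gt_mem_nhds hq1)] with α hα hqα
  rw [Pi.div_apply, le_div_iff₀ (sub_pos.2 hqα)]
  have := sqDist_le hp0 hm hp hα hδ0
  linarith

/-! ### Asymptotics of the mean and convergence of `β / α` -/

/-- With `β / a = U + W` and `S / (m a) = X + W`, the integrated recursion gives `(m - λ) / a = m E
((U + W)(X + W))`. Cauchy–Schwarz removes every term except `W²`. -/
theorem tendsto_sub_bias_div_meanEscape (hp0 : p 0 = 0) (hm : 1 < mean p)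
    (hp : Integrable (fun k : ℕ => (k : ℝ) ^ 2) p.toMeasure) :
    Tendsto (fun α => (mean p - bias p α) / meanEscape p α) (𝓝[>] 0)
      (𝓝 (mean p * ∫ ω, limitW p ω ^ 2 ∂(galtonWatson p))) := by
  have hm0 : mean p ≠ 0 := by linarith
  set ρ := ∫ ω, limitW p ω ^ 2 ∂(galtonWatson p) with hρ
  have hW := memLp_limitW hm hp
  have hD := tendsto_sqDist hp0 hm hp
  have hsD : Tendsto (fun α => √(sqDist p α)) (𝓝[>] 0) (𝓝 0) := by
    simpa using hD.sqrt
  have hsX : Tendsto (fun α => √(sqDist p α / mean p)) (𝓝[>] 0) (𝓝 0) := by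
    simpa using (hD.div_const (mean p)).sqrt
  have hB : Tendsto (fun α => mean p * (√ρ * √(sqDist p α / mean p) +
      √(sqDist p α) * √(sqDist p α / mean p) + √(sqDist p α) * √ρ)) (𝓝[>] 0) (𝓝 0) := by
    simpa using (((hsX.const_mul (√ρ)).add (hsD.mul hsX)).add (hsD.mul_const (√ρ))).const_mul
      (mean p)
  rw [tendsto_iff_dist_tendsto_zero]
  refine tendsto_of_tendsto_of_tendsto_of_le_of_le' tendsto_const_nhds hB
    (Eventually.of_forall fun _ => dist_nonneg) ?_
  filter_upwards [self_mem_nhdsWithin] with α hα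
  have ha : meanEscape p α ≠ 0 := (integral_escapeRoot_pos hp0 hm hp hα).ne'
  have hU := memLp_normalized hp0 hm hp α
  have hX := memLp_branchDiff hp0 hm hp α
  set U : Tree → ℝ := fun ω => escapeRoot p α ω / meanEscape p α - limitW p ω with hUdef
  set X := branchDiff p α with hXdef
  have hWX : Integrable (fun ω => limitW p ω * X ω) (galtonWatson p) := hW.integrable_mul hX
  have hUX : Integrable (fun ω => U ω * X ω) (galtonWatson p) := hU.integrable_mul hX
  have hUW : Integrable (fun ω => U ω * limitW p ω) (galtonWatson p) := hU.integrable_mul hW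
  have hWW := hW.integrable_sq
  have hs1 : Integrable (fun ω => limitW p ω * X ω + U ω * X ω) (galtonWatson p) := hWX.add hUX
  have hs2 : Integrable (fun ω => limitW p ω * X ω + U ω * X ω + U ω * limitW p ω)
      (galtonWatson p) := hs1.add hUW
  have h1 : (mean p - bias p α) / meanEscape p α = mean p *
      ∫ ω, ((limitW p ω * X ω + U ω * X ω + U ω * limitW p ω) + limitW p ω ^ 2)
        ∂(galtonWatson p) := by
    have h2 := sub_bias_mul_meanEscape hp0 hm hp α
    have h3 : ∀ ω, (limitW p ω * X ω + U ω * X ω + U ω * limitW p ω) + limitW p ω ^ 2 =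
        escapeRoot p α ω * subtreeSum (escapeRoot p α) ω / (mean p * meanEscape p α ^ 2) := by
      intro ω
      simp only [hUdef, hXdef, branchDiff]
      field_simp
      ring
    simp_rw [h3]
    rw [integral_div, ← h2]
    field_simp
  rw [integral_add hs2 hWW, integral_add hs1 hUW, integral_add hWX hUX, ← hρ] at h1
  have hXe : ∫ ω, X ω ^ 2 ∂(galtonWatson p) = sqDist p α / mean p :=
    integral_sq_branchDiff hp0 hm hp hα
  have hUe : ∫ ω, U ω ^ 2 ∂(galtonWatson p) = sqDist p α := rfl
  have c1 := abs_integral_mul_le_sqrt hW hX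
  have c2 := abs_integral_mul_le_sqrt hU hX
  have c3 := abs_integral_mul_le_sqrt hU hW
  rw [hXe] at c1 c2
  rw [hUe] at c2 c3
  rw [h1, Real.dist_eq, ← mul_sub, add_sub_cancel_right, abs_mul, abs_of_pos (by linarith)]
  refine mul_le_mul_of_nonneg_left ?_ (by linarith)
  refine (abs_add_le _ _).trans (add_le_add ((abs_add_le _ _).trans (add_le_add c1 c2)) c3)

lemma tendsto_sub_bias_div (p : PMF ℕ) :
    Tendsto (fun α => (mean p - bias p α) / α) (𝓝[>] 0) (𝓝 (mean p)) := by
  have h : HasDerivAt (fun α : ℝ => mean p - bias p α) (mean p) 0 := by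
    have h1 : HasDerivAt (fun α : ℝ => Real.exp (-α)) (Real.exp (-0) * (-1)) 0 :=
      (hasDerivAt_neg (0 : ℝ)).exp
    have h2 := (h1.const_mul (mean p)).const_sub (mean p)
    simpa [bias] using h2
  have h3 := h.tendsto_slope_zero_right
  refine h3.congr fun α => ?_
  simp [bias, div_eq_inv_mul]

theorem tendsto_meanEscape_div (hp0 : p 0 = 0) (hm : 1 < mean p)
    (hp : Integrable (fun k : ℕ => (k : ℝ) ^ 2) p.toMeasure) :
    Tendsto (fun α => meanEscape p α / α) (𝓝[>] 0)
      (𝓝 (∫ ω, limitW p ω ^ 2 ∂(galtonWatson p))⁻¹) := by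
  have hm0 : mean p ≠ 0 := by linarith
  have hρ := one_le_integral_sq_limitW hm hp
  set ρ := ∫ ω, limitW p ω ^ 2 ∂(galtonWatson p)
  have h := (tendsto_sub_bias_div p).div (tendsto_sub_bias_div_meanEscape hp0 hm hp)
    (mul_ne_zero hm0 (by linarith))
  have e : mean p / (mean p * ρ) = ρ⁻¹ := by field_simp
  rw [e] at h
  refine h.congr' ?_
  filter_upwards [self_mem_nhdsWithin] with α hα
  have hα' : (0 : ℝ) < α := hα
  have ha : meanEscape p α ≠ 0 := (integral_escapeRoot_pos hp0 hm hp hα).ne'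
  have hb : mean p - bias p α ≠ 0 := by
    have : bias p α < mean p :=
      mul_lt_of_lt_one_right (by linarith) (by simpa using hα')
    linarith
  rw [Pi.div_apply]
  field_simp

theorem tendstoInMeasure_escapeRoot_div (hp0 : p 0 = 0) (hm : 1 < mean p)
    (hp : Integrable (fun k : ℕ => (k : ℝ) ^ 2) p.toMeasure) :
    TendstoInMeasure (galtonWatson p) (fun (α : ℝ) ω => escapeRoot p α ω / α) (𝓝[>] 0)
      (fun ω => limitW p ω / ∫ ω', limitW p ω' ^ 2 ∂(galtonWatson p)) := by
  set ρ := ∫ ω, limitW p ω ^ 2 ∂(galtonWatson p) with hρ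
  have hW := memLp_limitW hm hp
  have hWρ : MemLp (fun ω => limitW p ω / ρ) 2 (galtonWatson p) := by
    simp only [div_eq_inv_mul]
    exact hW.const_mul _
  have hβ (α : ℝ) : MemLp (fun ω => escapeRoot p α ω / α) 2 (galtonWatson p) := by
    simp only [div_eq_inv_mul]
    exact (memLp_escapeRoot hp0 hm α).const_mul _
  refine tendstoInMeasure_of_tendsto_eLpNorm two_ne_zero (fun α => (hβ α).1) hWρ.1 ?_
  have hlim : Tendsto (fun α => 2 * (meanEscape p α / α) ^ 2 * sqDist p α +
      2 * (meanEscape p α / α - ρ⁻¹) ^ 2 * ρ) (𝓝[>] 0) (𝓝 0) := by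
    have h1 := tendsto_meanEscape_div hp0 hm hp
    rw [← hρ] at h1
    have h2 := (((h1.pow 2).const_mul 2).mul (tendsto_sqDist hp0 hm hp)).add
      ((((h1.sub_const ρ⁻¹).pow 2).const_mul 2).mul_const ρ)
    simpa using h2
  have hsq : Tendsto (fun α : ℝ => ∫ ω, (escapeRoot p α ω / α - limitW p ω / ρ) ^ 2
      ∂(galtonWatson p)) (𝓝[>] 0) (𝓝 0) := by
    refine tendsto_of_tendsto_of_tendsto_of_le_of_le' tendsto_const_nhds hlim
      (Eventually.of_forall fun _ => integral_nonneg fun _ => sq_nonneg _) ?_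
    filter_upwards [self_mem_nhdsWithin] with α hα
    have ha : meanEscape p α ≠ 0 := (integral_escapeRoot_pos hp0 hm hp hα).ne'
    have hU := (memLp_normalized hp0 hm hp α).integrable_sq.const_mul
      (2 * (meanEscape p α / α) ^ 2)
    have hW2 := hW.integrable_sq.const_mul (2 * (meanEscape p α / α - ρ⁻¹) ^ 2)
    rw [sqDist, hρ, ← integral_const_mul, ← integral_const_mul, ← hρ, ← integral_add hU hW2]
    refine integral_mono ((hβ α).sub hWρ).integrable_sq (hU.add hW2) fun ω => ?_
    -- Separates the error in the shape of `β / a` from the error in the scale `a / α`.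
    have e : escapeRoot p α ω / α - limitW p ω / ρ =
        meanEscape p α / α * (escapeRoot p α ω / meanEscape p α - limitW p ω) +
          (meanEscape p α / α - ρ⁻¹) * limitW p ω := by
      have : meanEscape p α / α * (escapeRoot p α ω / meanEscape p α) = escapeRoot p α ω / α := by
        field_simp
      rw [mul_sub, this]
      ring
    beta_reduce
    rw [e]
    set u := meanEscape p α / α * (escapeRoot p α ω / meanEscape p α - limitW p ω) with hu
    set v := (meanEscape p α / α - ρ⁻¹) * limitW p ω with hv
    have e2 : 2 * (meanEscape p α / α) ^ 2 *
        (escapeRoot p α ω / meanEscape p α - limitW p ω) ^ 2 +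
        2 * (meanEscape p α / α - ρ⁻¹) ^ 2 * limitW p ω ^ 2 = 2 * u ^ 2 + 2 * v ^ 2 := by
      rw [hu, hv]; ring
    rw [e2]
    nlinarith [sq_nonneg (u - v)]
  have h3 : ∀ α : ℝ, eLpNorm ((fun ω => escapeRoot p α ω / α) - fun ω => limitW p ω / ρ) 2
      (galtonWatson p) = ENNReal.ofReal (√(∫ ω, (escapeRoot p α ω / α - limitW p ω / ρ) ^ 2
      ∂(galtonWatson p))) := fun α => eLpNorm_two_eq_ofReal_sqrt ((hβ α).sub hWρ)
  refine Tendsto.congr (fun α => (h3 α).symm) ?_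
  simpa using ENNReal.tendsto_ofReal hsq.sqrt

lemma integral_offspring_sq_sub (hp : Integrable (fun k : ℕ => (k : ℝ) ^ 2) p.toMeasure) :
    ∫ ω, ((ω [] : ℝ) ^ 2 - (ω [] : ℝ)) ∂(galtonWatson p) = secondMoment p - mean p := by
  have h := measurePreserving_root p
  have h1 : ∫ ω : Tree, ((ω [] : ℝ) ^ 2 - (ω [] : ℝ)) ∂(galtonWatson p) =
      ∫ k : ℕ, ((k : ℝ) ^ 2 - (k : ℝ)) ∂p.toMeasure := by
    rw [← h.map_eq, integral_map h.measurable.aemeasurable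
      (measurable_of_countable _).aestronglyMeasurable]
  rw [h1, integral_sub hp (integrable_offspring hp), secondMoment_eq_integral hp,
    mean_eq_integral hp]

end

end GWWalk

open GWWalk
theorem proposition3p1 (p : PMF ℕ) (hp0 : p 0 = 0) (hm : 1 < mean p)
    (hexp : ∃ b : ℝ, 1 < b ∧ Summable fun k : ℕ => b ^ k * (p k).toReal) :
    -- the limits that define `β(o)` and `W_o` exist almost surely
    (∀ α : ℝ, 0 < α → ∀ᵐ ω ∂(galtonWatson p),
      Tendsto (fun n => escapeBeforeRoot ω (bias p α) n) atTop (𝓝 (escapeRoot p α ω))) ∧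
    (∀ᵐ ω ∂(galtonWatson p),
      Tendsto (fun n => martingaleW p ω n) atTop (𝓝 (limitW p ω))) ∧
    (∀ α : ℝ, 0 < α → Integrable (escapeRoot p α) (galtonWatson p)) ∧
    Integrable (fun ω => limitW p ω ^ 2) (galtonWatson p) ∧
    ∃ (Ω' : Type) (_ : MeasurableSpace Ω') (P' : Measure Ω') (_ : IsProbabilityMeasure P')
      (Y : Ω' → ℝ),
      TendstoInDistribution (fun (α : ℝ) (ω : Tree) => escapeRoot p α ω / α) (𝓝[>] 0) Y
        (fun _ => galtonWatson p) P' ∧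
      Integrable Y P' ∧
      Tendsto (fun α : ℝ => ∫ ω, escapeRoot p α ω / α ∂(galtonWatson p)) (𝓝[>] 0)
        (𝓝 (∫ y, Y y ∂P')) ∧
      ∫ y, Y y ∂P' =
        mean p * (mean p - 1) / ∫ ω, ((ω [] : ℝ) ^ 2 - (ω [] : ℝ)) ∂(galtonWatson p) ∧
      mean p * (mean p - 1) / ∫ ω, ((ω [] : ℝ) ^ 2 - (ω [] : ℝ)) ∂(galtonWatson p) =
        diffusivity p / (2 * mean p) ∧
      IdentDistrib Y (fun ω => limitW p ω / ∫ ω', limitW p ω' ^ 2 ∂(galtonWatson p))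
        P' (galtonWatson p) := by
  have hp := integrable_sq_offspring p hexp
  have hW := memLp_limitW hm hp
  have hW1 := hW.integrable one_le_two
  have hρ := integral_sq_limitW hm hp
  have hYint : ∫ ω, limitW p ω / ∫ ω', limitW p ω' ^ 2 ∂(galtonWatson p) ∂(galtonWatson p) =
      (∫ ω', limitW p ω' ^ 2 ∂(galtonWatson p))⁻¹ := by
    rw [integral_div, integral_limitW hm hp, one_div]
  have hmeas (α : ℝ) : AEMeasurable (fun ω => escapeRoot p α ω / α) (galtonWatson p) :=
    (aestronglyMeasurable_escapeRoot hp0 hm α).aemeasurable.div_const α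
  -- The limit variable is realised on the space of trees itself as `W / E W²`; convergence in
  -- measure then yields convergence in law, and the equality in law is reflexivity.
  refine ⟨fun α _ => (ae_one_le_offspring hp0).mono fun ω hω => tendsto_escapeBeforeRoot hm α hω,
    ae_tendsto_martingaleW hm hp, fun α _ => (memLp_escapeRoot hp0 hm α).integrable one_le_two,
    hW.integrable_sq, Tree, inferInstance, galtonWatson p, inferInstance,
    fun ω => limitW p ω / ∫ ω', limitW p ω' ^ 2 ∂(galtonWatson p),
    (tendstoInMeasure_escapeRoot_div hp0 hm hp).tendstoInDistribution hmeas,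
    hW1.div_const _, ?_, ?_, ?_, .refl (hW.1.aemeasurable.div_const _)⟩
  · rw [hYint]
    simp only [integral_div]
    exact tendsto_meanEscape_div hp0 hm hp
  · rw [hYint, hρ, integral_offspring_sq_sub hp, inv_div]
  · have hm0 : mean p ≠ 0 := by linarith
    rw [integral_offspring_sq_sub hp, diffusivity]
    field_simp
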